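/- Let $p\ge 1$ and let $\Xi=\{\xi_1\le\dots\le\xi_{n+p+1}\}$, $n\ge p+1$, be a $(p+1)$-open knot vector: $a:=\xi_1=\dots=\xi_{p+1}<\xi_{p+2}$, $\xi_n<\xi_{n+1}=\dots=\xi_{n+p+1}=:b$, and suppose that every interior breakpoint has multiplicity at most $p$. Let $\mathbb S$ be the space of functions on $[a,b]$ spanned by the B-splines $B_{1,p},\dots,B_{n,p}$ of degree $p$ on $\Xi$, let $s=\sum_{i=1}^n c_iB_{i,p}\in\mathbb S$ and let $\mathrm{TOL}>0$. *The $L^2$ algorithm* (input: a tolerance $T>0$, a degree $q$, a $(q+1)$-basic knot vector $\Theta=\{\theta_i\}_{i=1}^{m+q+1}$ and control points $d_1,\dots,d_m$). For a spline $t=\sum_i d_iB_{i,q}$ let $\|t\|_\Theta=\big(\sum_i d_i^2\,\frac{\theta_{i+q+1}-\theta_i}{q+1}\big)^{1/2}$. For an interior breakpoint $\zeta$ let $\varepsilon_\zeta$ be the $\|\cdot\|_\Theta$-distance from the current spline to the spline space whose knot vector is obtained from the current one, $\Theta$, by lowering the multiplicity of $\zeta$ by one. While fewer knots have been removed than there were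 interior knots initially, and $\min_\zeta\varepsilon_\zeta<T$: choose a minimizing $\zeta$, replace $T$ by $T-\varepsilon_\zeta$, and remove the last knot $\theta_{i_0}$ equal to $\zeta$. If $\ell+1$ is the multiplicity of $\zeta$ in $\Theta$, the control points $d_{i_0-q-1},\dots,d_{i_0-\ell}$ are replaced by the $q+1-\ell$ components of the least squares solution of $E_{\rm loc}A_{\rm loc}\mathbf x=E_{\rm loc}(d_{i_0-q-1},\dots,d_{i_0-\ell})^T$, and the others are kept. Here $E_{\rm loc}$ is diagonal with entries $\big(\frac{\theta_{i+q+1}-\theta_i}{q+1}\big)^{1/2}$, $i=i_0-q-1,\dots,i_0-\ell$, and $A_{\rm loc}\in\mathbb R^{(q+2-\ell)\times(q+1-\ell)}$ has entries $\alpha_j$ at $(j,j)$, $1-\alpha_j$ at $(j,j-1)$ and zeros elsewhere, with $\alpha_j=\frac{\theta_{i_0}-\theta_{i_0-q-2+j}}{\theta_{i_0-1+j}-\theta_{i_0-q-2+j}}$. The output is the final knot vector and the final control points. *The $H^1$ algorithm* (input $\mathrm{TOL}$, $c$, $\Xi$). Let $\xi_i^*=\frac1p(\xi_{i+1}+\dots+\xi_{i+p})$.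 Apply the $L^2$ algorithm in degree $p-1$, with tolerance $\mathrm{TOL}/\sqrt{(b-a)^2+1}$, to the knot vector $\Xi'=\{\xi_i\}_{i=2}^{n+p}$ and the control points $c_i'=\frac{c_i-c_{i-1}}{\xi_i^*-\xi_{i-1}^*}$, $i=2,\dots,n$. Let $\hat\Xi'$ and $\hat c_2',\dots,\hat c_{\hat n}'$ be its output. Let $\hat\Xi$ be $\hat\Xi'$ with its first and its last knot repeated once more, let $\hat\xi_i^*$ be defined from $\hat\Xi$ as $\xi_i^*$ is from $\Xi$, and put $\hat c_1=c_1$, $\hat c_i=\hat c_i'(\hat\xi_i^*-\hat\xi_{i-1}^*)+\hat c_{i-1}$ for $i=2,\dots,\hat n$. Return $\hat c$ and $\hat\Xi$. **Theorem.** However ties among minimizers are broken, the $H^1$ algorithm finishes after finitely many steps and returns an output. The control points $c'$ on $\Xi'$ are those of the right derivative $s'$ of $s$ on $[a,b)$. For every possible output, $\hat\Xi$ is a $(p+1)$-open knot vector with the same end points $a,b$, obtained from $\Xi$ by removing knots (possibly none); its spline space satisfies $\hat{\mathbb S}\subseteq\mathbb S$; and the spline $\hat s=\sum_i\hat c_i\hat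 B_{i,p}\in\hat{\mathbb S}$ on $\hat\Xi$ satisfies $\hat s(a)=s(a)$ and $\hat s(x)=s(a)+\int_a^x\hat s'$ for $x\in[a,b]$, where $\hat s'$ is the spline returned by the $L^2$ algorithm. Moreover $s-\hat s\in H^1(a,b)$ and $$\|s-\hat s\|_{H^1}:=\big(\|s-\hat s\|_{L^2(a,b)}^2+\|(s-\hat s)'\|_{L^2(a,b)}^2\big)^{1/2}<\mathrm{TOL}.$$ -/

import Mathlib

open MeasureTheory Set
open scoped ENNReal ContDiff

noncomputable section

namespace KnotRemoval

/-! Sequences are indexed from `1`: a knot vector of degree `p` and dimension `n` is a map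
`ξ : ℕ → ℝ` of which only `ξ 1, …, ξ (n + p + 1)` are used, and a vector of control points is a map
`c : ℕ → ℝ` of which only `c 1, …, c n` are used. The underlying interval is
`[a, b] = [ξ (p + 1), ξ (n + 1)]`. -/

/-- The multiplicity of `x` among the interior knots `ξ (p + 2), …, ξ n`. -/
def knotMultiplicity (p n : ℕ) (ξ : ℕ → ℝ) (x : ℝ) : ℕ :=
  ((Finset.Icc (p + 2) n).filter fun i => ξ i = x).card

/-- `ξ 1 ≤ … ≤ ξ (n + p + 1)` is a `(p + 1)`-basic knot vector: the knots `ξ (p + 2), …, ξ n` lie in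
the open interval `(ξ (p + 1), ξ (n + 1))` and have multiplicities at most `p + 1`. -/
structure IsBasicKnotVector (p n : ℕ) (ξ : ℕ → ℝ) : Prop where
  dim : p + 1 ≤ n
  mono : ∀ i j, 1 ≤ i → i ≤ j → j ≤ n + p + 1 → ξ i ≤ ξ j
  left : ξ (p + 1) < ξ (p + 2)
  right : ξ n < ξ (n + 1)
  mult : ∀ i, p + 2 ≤ i → i ≤ n → knotMultiplicity p n ξ (ξ i) ≤ p + 1

/-- A `(p + 1)`-open knot vector: the first `p + 1` knots agree, and so do the last `p + 1`. -/
structure IsOpenKnotVector (p n : ℕ) (ξ : ℕ → ℝ) : Prop extends IsBasicKnotVector p n ξ where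
  first : ∀ i, 1 ≤ i → i ≤ p + 1 → ξ i = ξ (p + 1)
  last : ∀ i, n + 1 ≤ i → i ≤ n + p + 1 → ξ i = ξ (n + 1)

/-- The knots `ξ 1, …, ξ (n + p + 1)` as a list. -/
def knotList (p n : ℕ) (ξ : ℕ → ℝ) : List ℝ :=
  (List.range (n + p + 1)).map fun i => ξ (i + 1)

/-- The B-spline `B_{i,p}` by the Cox–de Boor recursion (with `0 / 0 = 0`). It is continuous from the
right at the points of `[a, b)` and continuous from the left at `b`, so that the B-splines sum to `1`
on the whole closed interval `[a, b]`. -/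
def bspline (b : ℝ) (ξ : ℕ → ℝ) : ℕ → ℕ → ℝ → ℝ
  | 0, i, x =>
    open Classical in
    if (x < b ∧ ξ i ≤ x ∧ x < ξ (i + 1)) ∨ (b ≤ x ∧ ξ i < x ∧ x ≤ ξ (i + 1)) then 1 else 0
  | p + 1, i, x =>
    (x - ξ i) / (ξ (i + p + 1) - ξ i) * bspline b ξ p i x
      + (ξ (i + p + 2) - x) / (ξ (i + p + 2) - ξ (i + 1)) * bspline b ξ p (i + 1) x

/-- The spline `∑ i = 1, …, n, c i * B_{i,p}`. -/
def spline (p n : ℕ) (ξ c : ℕ → ℝ) (x : ℝ) : ℝ :=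
  ∑ i ∈ Finset.Icc 1 n, c i * bspline (ξ (n + 1)) ξ p i x

/-- The spline space spanned by the B-splines; its members are regarded as functions on `[a, b]`, their
values elsewhere are irrelevant. -/
def splineSpace (p n : ℕ) (ξ : ℕ → ℝ) : Set (ℝ → ℝ) :=
  {f | ∃ c : ℕ → ℝ, EqOn f (spline p n ξ c) (Icc (ξ (p + 1)) (ξ (n + 1)))}

/-- The weight `ω_i = ((ξ (i + p + 1) - ξ i) / (p + 1)) ^ (1 / 2)`. -/
def weight (p : ℕ) (ξ : ℕ → ℝ) (i : ℕ) : ℝ :=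
  √((ξ (i + p + 1) - ξ i) / (p + 1))

/-- The `Ξ`-norm of the spline with control points `c`. -/
def xiNorm (p n : ℕ) (ξ c : ℕ → ℝ) : ℝ :=
  √(∑ i ∈ Finset.Icc 1 n, (c i) ^ 2 * ((ξ (i + p + 1) - ξ i) / (p + 1)))

/-- The knot vector with the `i₀`-th knot removed. -/
def removeKnot (i₀ : ℕ) (ξ : ℕ → ℝ) (i : ℕ) : ℝ :=
  if i < i₀ then ξ i else ξ (i + 1)

/-- `i₀` is the last index of an interior breakpoint; the interior breakpoints are in bijection with
these indices. -/
def IsBreakIndex (p n : ℕ) (ξ : ℕ → ℝ) (i₀ : ℕ) : Prop :=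
  p + 2 ≤ i₀ ∧ i₀ ≤ n ∧ ξ i₀ < ξ (i₀ + 1)

/-- The error indicator: the distance, in the `Ξ`-norm, between the spline `s` with control points `c`
and the spline space obtained by removing the `i₀`-th knot. -/
def indicator (p n : ℕ) (ξ c : ℕ → ℝ) (i₀ : ℕ) : ℝ :=
  sInf {r : ℝ | ∃ g ∈ splineSpace p (n - 1) (removeKnot i₀ ξ), ∃ d : ℕ → ℝ,
    EqOn (fun x => g x - spline p n ξ c x) (spline p n ξ d) (Icc (ξ (p + 1)) (ξ (n + 1))) ∧
    r = xiNorm p n ξ d}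

/-- The numbers `α_j`, `j = 1, …, p + 2 - ℓ`, of the local knot insertion matrix. -/
def alpha (p : ℕ) (ξ : ℕ → ℝ) (i₀ j : ℕ) : ℝ :=
  (ξ i₀ - ξ (i₀ + j - (p + 2))) / (ξ (i₀ + j - 1) - ξ (i₀ + j - (p + 2)))

/-- The local knot insertion matrix, bidiagonal with diagonal `α_1, …, α_{p + 1 - ℓ}` and subdiagonal
`1 - α_2, …, 1 - α_{p + 2 - ℓ}` (rows and columns are numbered from `0` here). -/
def Aloc (p ℓ : ℕ) (ξ : ℕ → ℝ) (i₀ : ℕ) : Matrix (Fin (p + 2 - ℓ)) (Fin (p + 1 - ℓ)) ℝ :=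
  Matrix.of fun r s =>
    if (s : ℕ) = r then alpha p ξ i₀ (r + 1)
    else if (s : ℕ) + 1 = r then 1 - alpha p ξ i₀ (r + 1)
    else 0

/-- The local scaling matrix, diagonal with entries `ω_{i₀ - p - 1}, …, ω_{i₀ - ℓ}`. -/
def Eloc (p ℓ : ℕ) (ξ : ℕ → ℝ) (i₀ : ℕ) : Matrix (Fin (p + 2 - ℓ)) (Fin (p + 2 - ℓ)) ℝ :=
  Matrix.diagonal fun r => weight p ξ (i₀ - (p + 1) + r)

/-- `x` is a least squares solution of `M x = y`. -/
def IsLeastSquares {k m : ℕ} (M : Matrix (Fin k) (Fin m) ℝ) (y : Fin k → ℝ) (x : Fin m → ℝ) : Prop :=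
  ∀ z : Fin m → ℝ, ∑ r, ((M.mulVec x - y) r) ^ 2 ≤ ∑ r, ((M.mulVec z - y) r) ^ 2

/-- `c'` is the vector of control points produced from `c` when the `i₀`-th knot, of multiplicity
`ℓ + 1`, is removed: the local control points `c (i₀ - p - 1), …, c (i₀ - ℓ)` are replaced by the least
squares solution of the local system, the other ones are kept. -/
def IsUpdate (p ℓ : ℕ) (ξ : ℕ → ℝ) (i₀ : ℕ) (c c' : ℕ → ℝ) : Prop :=
  (∀ i, i + (p + 2) ≤ i₀ → c' i = c i) ∧
  IsLeastSquares (Eloc p ℓ ξ i₀ * Aloc p ℓ ξ i₀)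
    ((Eloc p ℓ ξ i₀).mulVec fun r => c (i₀ - (p + 1) + r))
    (fun s => c' (i₀ - (p + 1) + s)) ∧
  (∀ i, i₀ ≤ i + ℓ → c' i = c (i + 1))

/-- The variables of the `L²` knot removal algorithm: the iteration counter, the dimension, the knot
vector, the control points, and what is left of the tolerance. -/
structure State where
  k : ℕ
  n : ℕ
  ξ : ℕ → ℝ
  c : ℕ → ℝ
  tol : ℝ

/-- `i₀` minimizes the error indicator among the interior breakpoints. Ties may be broken in any way. -/
def IsArgmin (p : ℕ) (S : State) (i₀ : ℕ) : Prop :=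
  IsBreakIndex p S.n S.ξ i₀ ∧
  ∀ i, IsBreakIndex p S.n S.ξ i → indicator p S.n S.ξ S.c i₀ ≤ indicator p S.n S.ξ S.c i

/-- The condition of the while loop, for a minimizing breakpoint `i₀`. -/
def LoopCondition (p kmax : ℕ) (S : State) (i₀ : ℕ) : Prop :=
  IsArgmin p S i₀ ∧ indicator p S.n S.ξ S.c i₀ < S.tol ∧ S.k < kmax

/-- One pass through the body of the while loop. -/
def Step (p kmax : ℕ) (S S' : State) : Prop :=
  ∃ i₀, LoopCondition p kmax S i₀ ∧
    S'.tol = S.tol - indicator p S.n S.ξ S.c i₀ ∧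
    IsUpdate p (knotMultiplicity p S.n S.ξ (S.ξ i₀) - 1) S.ξ i₀ S.c S'.c ∧
    S'.ξ = removeKnot i₀ S.ξ ∧
    S'.n = S.n - 1 ∧
    S'.k = S.k + 1

/-- The while loop is left in the state `S`. -/
def Halted (p kmax : ℕ) (S : State) : Prop := ¬ ∃ i₀, LoopCondition p kmax S i₀

/-- The number of interior knots, `(n + p + 1) - 2 (p + 1)`. -/
def numInterior (p n : ℕ) : ℕ := (n + p + 1) - 2 * (p + 1)

/-- The initial state of the `L²` algorithm. -/
def l2Start (n : ℕ) (ξ c : ℕ → ℝ) (tol : ℝ) : State := ⟨0, n, ξ, c, tol⟩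

/-- `S` can be reached from the start of the `L²` algorithm. -/
def L2Reaches (p n : ℕ) (ξ c : ℕ → ℝ) (tol : ℝ) (S : State) : Prop :=
  Relation.ReflTransGen (Step p (numInterior p n)) (l2Start n ξ c tol) S

/-- The `L²` algorithm may return the knot vector and the control points of the state `S`. -/
def L2Returns (p n : ℕ) (ξ c : ℕ → ℝ) (tol : ℝ) (S : State) : Prop :=
  L2Reaches p n ξ c tol S ∧ Halted p (numInterior p n) S

/-- The `L²` algorithm finishes, whatever way ties are broken: it never loops forever, and it never gets
stuck inside the loop. -/
def L2Finishes (p n : ℕ) (ξ c : ℕ → ℝ) (tol : ℝ) : Prop :=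
  (¬ ∃ σ : ℕ → State, σ 0 = l2Start n ξ c tol ∧
      ∀ m, Step p (numInterior p n) (σ m) (σ (m + 1))) ∧
  ∀ S, L2Reaches p n ξ c tol S → ¬ Halted p (numInterior p n) S →
    ∃ S', Step p (numInterior p n) S S'

/-- The Greville abscissa `(ξ (i + 1) + … + ξ (i + p)) / p`. -/
def greville (p : ℕ) (ξ : ℕ → ℝ) (i : ℕ) : ℝ := (∑ j ∈ Finset.Icc (i + 1) (i + p), ξ j) / p

/-- The knot vector of the derivative: the first knot (and, through the length, the last one) is
dropped. -/
def derivKnots (ξ : ℕ → ℝ) (i : ℕ) : ℝ := ξ (i + 1)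

/-- The control points of the derivative, numbered from `1` to `n - 1`. -/
def derivCoeff (p : ℕ) (ξ c : ℕ → ℝ) (i : ℕ) : ℝ :=
  (c (i + 1) - c i) / (greville p ξ (i + 1) - greville p ξ i)

/-- The knot vector `ξ' 1, …, ξ' N` with its first and its last knot repeated once more. -/
def primKnots (N : ℕ) (ξ' : ℕ → ℝ) (i : ℕ) : ℝ :=
  if i ≤ 1 then ξ' 1 else if i ≤ N + 1 then ξ' (i - 1) else ξ' N

/-- The control points of the primitive with knot vector `ξ` and first control point `c₁`, when `c'` are
the control points of the derivative, numbered from `1`. -/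
def primCoeff (p : ℕ) (ξ : ℕ → ℝ) (c₁ : ℝ) (c' : ℕ → ℝ) : ℕ → ℝ
  | 0 => c₁
  | 1 => c₁
  | i + 2 => c' (i + 1) * (greville p ξ (i + 2) - greville p ξ (i + 1)) + primCoeff p ξ c₁ c' (i + 1)

/-- The tolerance handed to the `L²` algorithm. -/
def h1Tol (p n : ℕ) (ξ : ℕ → ℝ) (tol : ℝ) : ℝ :=
  tol / √((ξ (n + 1) - ξ (p + 1)) ^ 2 + 1)

/-- The `H¹` algorithm finishes, that is, its call of the `L²` algorithm for the derivative does. -/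
def H1Finishes (p n : ℕ) (ξ c : ℕ → ℝ) (tol : ℝ) : Prop :=
  L2Finishes (p - 1) (n - 1) (derivKnots ξ) (derivCoeff p ξ c) (h1Tol p n ξ tol)

/-- The `H¹` algorithm may return the control points `ĉ` and the knot vector `ξ̂` (of dimension `n̂`),
after its call of the `L²` algorithm returned the control points `ĉ'` and the knot vector `ξ̂'` (of
dimension `n̂'`). -/
def H1Returns (p n : ℕ) (ξ c : ℕ → ℝ) (tol : ℝ)
    (n' : ℕ) (ξ' c' : ℕ → ℝ) (nhat : ℕ) (ξhat chat : ℕ → ℝ) : Prop :=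
  (∃ S, L2Returns (p - 1) (n - 1) (derivKnots ξ) (derivCoeff p ξ c) (h1Tol p n ξ tol) S ∧
    S.n = n' ∧ S.ξ = ξ' ∧ S.c = c') ∧
  nhat = n' + 1 ∧ ξhat = primKnots (n' + p) ξ' ∧ chat = primCoeff p ξhat (c 1) c'

/-- `v` is the weak derivative of `u` on `(a, b)`. -/
def IsWeakDeriv (a b : ℝ) (u v : ℝ → ℝ) : Prop :=
  LocallyIntegrableOn u (Ioo a b) ∧ LocallyIntegrableOn v (Ioo a b) ∧
  ∀ φ : ℝ → ℝ, ContDiff ℝ ∞ φ → HasCompactSupport φ → tsupport φ ⊆ Ioo a b →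
    ∫ x in Ioo a b, u x * deriv φ x = - ∫ x in Ioo a b, v x * φ x

/-- The norm of `H¹(a, b)`, with value `∞` for functions that are not in `H¹(a, b)`. The infimum is over
all representatives of the weak derivative. -/
def h1Norm (a b : ℝ) (u : ℝ → ℝ) : ℝ≥0∞ :=
  ⨅ (v : ℝ → ℝ) (_ : IsWeakDeriv a b u v),
    ((eLpNorm u 2 (volume.restrict (Ioo a b))) ^ 2
      + (eLpNorm v 2 (volume.restrict (Ioo a b))) ^ 2) ^ (1 / 2 : ℝ)

end KnotRemoval

end

open KnotRemoval

namespace KnotRemoval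

open Filter Topology

/-! ### B-splines on a monotone knot sequence -/

/-! The algorithm approximates `s'` in `L²` and integrates the result. If `u = s - ŝ`, then `u(a) =
0`, and Cauchy–Schwarz gives `|u| ≤ √(b - a) ‖u'‖`, hence `‖u‖ ≤ (b - a) ‖u'‖` and an `H¹` norm of
at most `√((b - a)² + 1) ‖u'‖`. This is the factor by which the tolerance is divided (`h1Norm_lt`).

For the `L²` algorithm the invariant is: the error so far is at most the initial tolerance minus
what is left of it, and what is left is positive (`IsApproximation`). A pass preserves it by the
triangle inequality, provided the spline moves by at most the indicator in `L²`. Two facts give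
this. Knot insertion (`bspline_removeKnot`, `spline_removeKnot`) writes the new spline on the old
knots; away from a window the insertion matrix only copies control points, so the local least
squares solution is a global best approximation (`xiNorm_update_le_indicator`). Linear independence
enters here, since the distance is defined through functions and the norm through coefficients.
Secondly, the `Ξ`-norm dominates the `L²` norm (`eLpNorm_spline_le`), by Jensen's inequality for the
partition of unity. Strictness of the final bound comes from the positive remainder, termination
from the counter.

The calculus is one-sided: the derivative formula for B-splines holds from the right at every point
of `[a, b)`, and splines are continuous when interior multiplicities do not exceed the degree, so
the fundamental theorem of calculus for right derivatives applies without exceptional points. -/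

/-- The knot `y` lies before the evaluation point `x`; the convention at `y = x` is the one of
`bspline b`: right continuous for `x < b`, left continuous for `b ≤ x`. -/
def Before (b x y : ℝ) : Prop := y < x ∨ (y = x ∧ x < b)

theorem Before.le {b x y : ℝ} (h : Before b x y) : y ≤ x := by
  rcases h with h | h
  · exact h.le
  · exact h.1.le

theorem Before.mono {b x y z : ℝ} (h : Before b x y) (hz : z ≤ y) : Before b x z := by
  unfold Before at *
  rcases h with h | ⟨h, hb⟩
  · exact Or.inl (lt_of_le_of_lt hz h)
  · rcases hz.lt_or_eq with h1 | h1
    · exact Or.inl (h ▸ h1)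
    · exact Or.inr ⟨h1.trans h, hb⟩

theorem le_of_not_before {b x y : ℝ} (h : ¬ Before b x y) : x ≤ y := by
  by_contra h1
  exact h (Or.inl (not_le.1 h1))

theorem before_iff_of_lt {b x y : ℝ} (h : x < b) : Before b x y ↔ y ≤ x := by
  unfold Before
  rw [le_iff_lt_or_eq]
  tauto

theorem before_iff_of_le {b x y : ℝ} (h : b ≤ x) : Before b x y ↔ y < x := by
  unfold Before
  have := not_lt.2 h
  tauto

open Classical in
theorem bspline_zero (b : ℝ) (ξ : ℕ → ℝ) (i : ℕ) (x : ℝ) :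
    bspline b ξ 0 i x = if Before b x (ξ i) ∧ ¬ Before b x (ξ (i + 1)) then 1 else 0 := by
  rw [bspline]
  rcases lt_or_ge x b with h | h
  · simp [before_iff_of_lt h, h, not_le.2 h]
  · simp [before_iff_of_le h, h, not_lt.2 h]

theorem bspline_succ (b : ℝ) (ξ : ℕ → ℝ) (p i : ℕ) (x : ℝ) :
    bspline b ξ (p + 1) i x = (x - ξ i) / (ξ (i + p + 1) - ξ i) * bspline b ξ p i x
      + (ξ (i + p + 2) - x) / (ξ (i + p + 2) - ξ (i + 1)) * bspline b ξ p (i + 1) x := by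
  rw [bspline]

theorem bspline_congr {b : ℝ} {ξ η : ℕ → ℝ} {p i : ℕ}
    (h : ∀ j, i ≤ j → j ≤ i + p + 1 → ξ j = η j) (x : ℝ) :
    bspline b ξ p i x = bspline b η p i x := by
  induction p generalizing i with
  | zero => rw [bspline_zero, bspline_zero, h i (by omega) (by omega),
      h (i + 1) (by omega) (by omega)]
  | succ p ih =>
    rw [bspline_succ, bspline_succ, ih fun j h1 h2 => h j h1 (by omega),
      ih fun j h1 h2 => h j (by omega) (by omega), h i (by omega) (by omega),
      h (i + 1) (by omega) (by omega), h (i + p + 1) (by omega) (by omega),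
      h (i + p + 2) (by omega) (by omega)]

theorem bspline_shift (b : ℝ) (ξ : ℕ → ℝ) (p i k : ℕ) (x : ℝ) :
    bspline b (fun j => ξ (j + k)) p i x = bspline b ξ p (i + k) x := by
  induction p generalizing i with
  | zero => rw [bspline_zero, bspline_zero, show i + 1 + k = i + k + 1 by omega]
  | succ p ih =>
    rw [bspline_succ, bspline_succ, ih, ih]
    simp only [show i + p + 1 + k = i + k + p + 1 by omega,
      show i + p + 2 + k = i + k + p + 2 by omega, show i + 1 + k = i + k + 1 by omega]

section Monotone

variable {b x : ℝ} {ξ : ℕ → ℝ}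

theorem bspline_eq_zero_of_not_before (hξ : Monotone ξ) {p i : ℕ} (h : ¬ Before b x (ξ i)) :
    bspline b ξ p i x = 0 := by
  induction p generalizing i with
  | zero => rw [bspline_zero]; simp [h]
  | succ p ih =>
    rw [bspline_succ, ih h, ih fun h1 => h (h1.mono (hξ (by omega)))]
    simp

theorem bspline_eq_zero_of_before (hξ : Monotone ξ) {p i : ℕ} (h : Before b x (ξ (i + p + 1))) :
    bspline b ξ p i x = 0 := by
  induction p generalizing i with
  | zero => rw [bspline_zero, if_neg]; exact fun h1 => h1.2 h
  | succ p ih =>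
    rw [bspline_succ, ih (h.mono (hξ (by omega))),
      ih (by rwa [show i + 1 + p + 1 = i + (p + 1) + 1 by omega])]
    simp

/-- No point separates two equal knots. This is why the convention `0 / 0 = 0` is harmless: a
quotient with vanishing denominator always multiplies a vanishing B-spline. -/
theorem bspline_eq_zero_of_eq (hξ : Monotone ξ) {p i : ℕ} (h : ξ (i + p + 1) = ξ i) :
    bspline b ξ p i x = 0 := by
  by_cases h1 : Before b x (ξ i)
  · exact bspline_eq_zero_of_before hξ (h ▸ h1)
  · exact bspline_eq_zero_of_not_before hξ h1

theorem bspline_nonneg (hξ : Monotone ξ) (p i : ℕ) : 0 ≤ bspline b ξ p i x := by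
  induction p generalizing i with
  | zero => rw [bspline_zero]; split_ifs <;> norm_num
  | succ p ih =>
    rw [bspline_succ]
    refine add_nonneg ?_ ?_
    · by_cases h : Before b x (ξ i)
      · exact mul_nonneg (div_nonneg (sub_nonneg.2 h.le) (sub_nonneg.2 (hξ (by omega)))) (ih i)
      · rw [bspline_eq_zero_of_not_before hξ h]; simp
    · by_cases h : Before b x (ξ (i + p + 2))
      · rw [bspline_eq_zero_of_before (i := i + 1) hξ
          (by rwa [show i + 1 + p + 1 = i + p + 2 by omega])]; simp
      · exact mul_nonneg (div_nonneg (sub_nonneg.2 (le_of_not_before h))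
          (sub_nonneg.2 (hξ (by omega)))) (ih _)

theorem weight_add_weight_mul_bspline (hξ : Monotone ξ) (p i : ℕ) :
    (x - ξ i) / (ξ (i + p + 1) - ξ i) * bspline b ξ p i x
      + (ξ (i + p + 1) - x) / (ξ (i + p + 1) - ξ i) * bspline b ξ p i x = bspline b ξ p i x := by
  by_cases h : ξ (i + p + 1) = ξ i
  · rw [bspline_eq_zero_of_eq hξ h]; simp
  · have := sub_ne_zero.2 h
    field_simp
    ring

/-- Partition of unity. -/
theorem sum_bspline (hξ : Monotone ξ) {p m N : ℕ} (h1 : Before b x (ξ (m + p)))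
    (h2 : ¬ Before b x (ξ (m + N))) : ∑ r ∈ Finset.range N, bspline b ξ p (m + r) x = 1 := by
  classical
  induction p generalizing m N with
  | zero =>
    have h3 : ∀ r, bspline b ξ 0 (m + r) x = (if Before b x (ξ (m + r)) then (1 : ℝ) else 0)
        - (if Before b x (ξ (m + (r + 1))) then (1 : ℝ) else 0) := by
      intro r
      rw [bspline_zero]
      by_cases h : Before b x (ξ (m + (r + 1)))
      · have h' : Before b x (ξ (m + r)) := h.mono (hξ (by omega))
        rw [← add_assoc] at h ⊢
        simp [h, h']
      · rw [← add_assoc] at h ⊢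
        simp [h]
    rw [Finset.sum_congr rfl fun r _ => h3 r,
      Finset.sum_range_sub' (fun r => if Before b x (ξ (m + r)) then (1 : ℝ) else 0)]
    simp [h2]
    simpa using h1
  | succ p ih =>
    obtain ⟨N, rfl⟩ : ∃ N', N = N' + 1 := by
      cases N with
      | zero => exact absurd (h1.mono (hξ (by omega))) h2
      | succ N => exact ⟨N, rfl⟩
    simp only [bspline_succ]
    rw [Finset.sum_add_distrib, Finset.sum_range_succ', Finset.sum_range_succ]
    -- After the recursion every inner B-spline of degree `p` occurs twice, with weights adding up
    -- to one; the two outermost occur once, but do not see `x`.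
    have e1 : bspline b ξ p (m + 0) x = 0 := bspline_eq_zero_of_before hξ h1
    have e2 : bspline b ξ p (m + N + 1) x = 0 := bspline_eq_zero_of_not_before hξ h2
    rw [e1, e2, mul_zero, mul_zero, add_zero, add_zero, ← Finset.sum_add_distrib,
      ← ih (m := m + 1) (N := N) (by rwa [show m + 1 + p = m + (p + 1) by omega])
        (by rwa [show m + 1 + N = m + (N + 1) by omega])]
    refine Finset.sum_congr rfl fun r _ => ?_
    rw [← weight_add_weight_mul_bspline hξ p (m + 1 + r)]
    simp only [show m + (r + 1) = m + 1 + r by omega, show m + r + 1 = m + 1 + r by omega,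
      show m + r + p + 2 = m + 1 + r + p + 1 by omega]

/-- The derivative of a B-spline from the right. -/
theorem hasDerivWithinAt_bspline (hξ : Monotone ξ) (hx : x < b) (p i : ℕ) :
    HasDerivWithinAt (bspline b ξ p i)
      (p * (bspline b ξ (p - 1) i x / (ξ (i + p) - ξ i)
        - bspline b ξ (p - 1) (i + 1) x / (ξ (i + p + 1) - ξ (i + 1)))) (Ici x) x := by
  induction p generalizing i with
  | zero =>
    -- Moving slightly to the right of `x < b` crosses no knot, so a B-spline of degree zero is
    -- locally constant from the right.
    have key : ∀ z, ∀ᶠ y in 𝓝[≥] x, (Before b y z ↔ Before b x z) := by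
      intro z
      have hb : ∀ᶠ y in 𝓝[≥] x, y < b := (eventually_lt_nhds hx).filter_mono nhdsWithin_le_nhds
      rw [before_iff_of_lt hx]
      rcases le_or_gt z x with h | h
      · filter_upwards [hb, self_mem_nhdsWithin] with y hy hy'
        rw [before_iff_of_lt hy]
        exact ⟨fun _ => h, fun _ => h.trans hy'⟩
      · have hz : ∀ᶠ y in 𝓝[≥] x, y < z := (eventually_lt_nhds h).filter_mono nhdsWithin_le_nhds
        filter_upwards [hb, hz] with y hy hy'
        rw [before_iff_of_lt hy]
        exact ⟨fun h1 => absurd hy' (not_lt.2 h1), fun h1 => absurd h (not_lt.2 h1)⟩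
    have h0 : bspline b ξ 0 i =ᶠ[𝓝[≥] x] fun _ => bspline b ξ 0 i x := by
      filter_upwards [key (ξ i), key (ξ (i + 1))] with y h1 h2
      rw [bspline_zero, bspline_zero]
      classical
      exact if_congr (and_congr h1 (not_congr h2)) rfl rfl
    rw [Nat.cast_zero, zero_mul]
    exact (hasDerivWithinAt_const x _ (bspline b ξ 0 i x)).congr_of_eventuallyEq h0 rfl
  | succ p ih =>
    have h1 : HasDerivWithinAt (fun y => (y - ξ i) / (ξ (i + p + 1) - ξ i))
        (1 / (ξ (i + p + 1) - ξ i)) (Ici x) x :=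
      ((hasDerivWithinAt_id x _).sub_const _).div_const _
    have h2 : HasDerivWithinAt (fun y => (ξ (i + p + 2) - y) / (ξ (i + p + 2) - ξ (i + 1)))
        (-1 / (ξ (i + p + 2) - ξ (i + 1))) (Ici x) x :=
      ((hasDerivWithinAt_id x _).const_sub _).div_const _
    have h3 := (h1.mul (ih i)).add (h2.mul (ih (i + 1)))
    have h4 : bspline b ξ (p + 1) i = (fun y => (y - ξ i) / (ξ (i + p + 1) - ξ i)) * bspline b ξ p i
        + (fun y => (ξ (i + p + 2) - y) / (ξ (i + p + 2) - ξ (i + 1))) * bspline b ξ p (i + 1) := by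
      funext y
      exact bspline_succ b ξ p i y
    rw [h4]
    refine h3.congr_deriv ?_
    rw [show i + 1 + p + 1 = i + p + 2 by omega, show i + 1 + p = i + p + 1 by omega,
      show i + (p + 1) + 1 = i + p + 2 by omega, show i + (p + 1) = i + p + 1 by omega,
      Nat.add_sub_cancel]
    cases p with
    | zero => simp; ring
    | succ q =>
      rw [Nat.add_sub_cancel, bspline_succ b ξ q i, bspline_succ b ξ q (i + 1)]
      rw [show i + (q + 1) + 1 = i + q + 2 by omega, show i + (q + 1) + 2 = i + q + 3 by omega,
        show i + (q + 1) = i + q + 1 by omega, show i + 1 + q + 2 = i + q + 3 by omega,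
        show i + 1 + q + 1 = i + q + 2 by omega, show i + 1 + 1 = i + 2 by omega]
      have d1 : ξ i ≤ ξ (i + 1) := hξ (by omega)
      have d2 : ξ (i + 1) ≤ ξ (i + 2) := hξ (by omega)
      have d3 : ξ (i + 2) ≤ ξ (i + q + 2) := hξ (by omega)
      have d4 : ξ (i + q + 2) ≤ ξ (i + q + 3) := hξ (by omega)
      have d5 : ξ (i + 1) ≤ ξ (i + q + 1) := hξ (by omega)
      have d6 : ξ (i + q + 1) ≤ ξ (i + q + 2) := hξ (by omega)
      generalize bspline b ξ q i x = A
      generalize bspline b ξ q (i + 1) x = B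
      generalize bspline b ξ q (i + 2) x = C
      generalize ξ i = a0 at *
      generalize ξ (i + 1) = a1 at *
      generalize ξ (i + 2) = a2 at *
      generalize ξ (i + q + 1) = b1 at *
      generalize ξ (i + q + 2) = b2 at *
      generalize ξ (i + q + 3) = b3 at *
      -- By the product rule and the recursion both sides are combinations of three B-splines of
      -- degree `q`. The coefficients of the outer ones, `A` and `C`, agree at sight; this is the
      -- identity for the middle one.
      have hB : (b3 - x) / (b3 - a1) * (B / (b2 - a1)) - (x - a0) / (b2 - a0) * (B / (b2 - a1))
          = (b2 - x) / (b2 - a1) * B / (b2 - a0) - (x - a1) / (b2 - a1) * B / (b3 - a1) := by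
        rcases (d5.trans d6).eq_or_lt with h | h
        · simp [h]
        · have n1 : b2 - a1 ≠ 0 := (sub_pos.2 h).ne'
          have n2 : b2 - a0 ≠ 0 := (sub_pos.2 (d1.trans_lt h)).ne'
          have n3 : b3 - a1 ≠ 0 := (sub_pos.2 (h.trans_le d4)).ne'
          field_simp
          ring
      push_cast
      linear_combination ((q : ℝ) + 1) * hB

end Monotone

/-! ### One-sided limits, continuity and local linear independence -/

/-- Replacing the parameter `b` by `x` selects the left continuous convention at `x`, so left limits
obey the same recursion and continuity at `x` becomes independence of that parameter. -/
theorem tendsto_bspline_left {b x : ℝ} (ξ : ℕ → ℝ) (p i : ℕ) :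
    Tendsto (bspline b ξ p i) (𝓝[<] x) (𝓝 (bspline x ξ p i x)) := by
  induction p generalizing i with
  | zero =>
    have key : ∀ z, ∀ᶠ y in 𝓝[<] x, (Before b y z ↔ Before x x z) := by
      intro z
      rw [before_iff_of_le le_rfl]
      rcases lt_or_ge z x with h | h
      · have hz : ∀ᶠ y in 𝓝[<] x, z < y := (eventually_gt_nhds h).filter_mono nhdsWithin_le_nhds
        filter_upwards [hz] with y hy
        exact ⟨fun _ => h, fun _ => Or.inl hy⟩
      · filter_upwards [self_mem_nhdsWithin] with y hy
        exact ⟨fun h1 => absurd (h1.le.trans_lt hy) (not_lt.2 h), fun h1 => absurd h1 (not_lt.2 h)⟩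
    refine tendsto_const_nhds.congr' ?_
    filter_upwards [key (ξ i), key (ξ (i + 1))] with y h1 h2
    rw [bspline_zero, bspline_zero]
    classical
    exact if_congr (and_congr h1 (not_congr h2)).symm rfl rfl
  | succ p ih =>
    rw [bspline_succ]
    simp only [funext (bspline_succ b ξ p i)]
    have hid : Tendsto (fun y : ℝ => y) (𝓝[<] x) (𝓝 x) := tendsto_id.mono_left nhdsWithin_le_nhds
    exact (((hid.sub_const _).div_const _).mul (ih i)).add
      (((hid.const_sub _).div_const _).mul (ih (i + 1)))

section Monotone

variable {b x : ℝ} {ξ : ℕ → ℝ}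

/-- The knots from `i + 1` to `i + p + 1` all equal `x`, so at each level of the recursion the
second weight vanishes and the first is `(x - ξ i) / (x - ξ i)`. -/
theorem bspline_eq_one_of_run_end (hξ : Monotone ξ) {p i : ℕ} (h1 : Before b x (ξ i))
    (h2 : ¬ Before b x (ξ (i + 1))) (h3 : ξ (i + 1) = x) (h4 : ξ (i + p + 1) = x) :
    bspline b ξ p i x = 1 := by
  induction p with
  | zero => rw [bspline_zero, if_pos ⟨h1, h2⟩]
  | succ p ih =>
    have h5 : ξ (i + p + 1) = x := le_antisymm (h4 ▸ hξ (by omega)) (h3 ▸ hξ (by omega))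
    rw [bspline_succ, ih h5, show ξ (i + p + 2) = x from h4, h5, div_self]
    · simp
    · intro h6
      rw [← sub_eq_zero.1 h6, ← h3] at h1
      rw [← h3] at h2
      exact h2 h1

theorem bspline_eq_one_of_run_start (hξ : Monotone ξ) {p i : ℕ} (h1 : Before b x (ξ (i + p)))
    (h2 : ¬ Before b x (ξ (i + p + 1))) (h3 : ξ i = x) (h4 : ξ (i + p) = x) :
    bspline b ξ p i x = 1 := by
  induction p generalizing i with
  | zero => rw [bspline_zero, if_pos ⟨h1, h2⟩]
  | succ p ih =>
    have h5 : ξ (i + 1) = x := le_antisymm (h4 ▸ hξ (by omega)) (h3 ▸ hξ (by omega))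
    have e : i + 1 + p = i + (p + 1) := by omega
    rw [bspline_succ, ih (by rwa [e]) (by rwa [e]) h5 (by rwa [e]), h3, h5, div_self]
    · simp
    · intro h6
      apply h2
      rw [show i + (p + 1) + 1 = i + p + 2 by omega, sub_eq_zero.1 h6, ← h4]
      rwa [h4] at h1 ⊢

/-- A B-spline is continuous at `x` if less than `p + 1` consecutive knots are equal to `x`. -/
theorem bspline_eq_left_limit (hξ : Monotone ξ) (hx : x < b) {p i : ℕ}
    (h1 : ¬ (ξ i = x ∧ ξ (i + p) = x)) (h2 : ¬ (ξ (i + 1) = x ∧ ξ (i + p + 1) = x)) :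
    bspline b ξ p i x = bspline x ξ p i x := by
  have hR := fun y => before_iff_of_lt (y := y) hx
  have hL := fun y => before_iff_of_le (y := y) (le_refl x)
  induction p generalizing i with
  | zero =>
    simp only [add_zero, and_self] at h1 h2
    simp only [bspline_zero, hR, hL, lt_iff_le_and_ne, h1, h2, ne_eq, not_false_eq_true, and_true]
  | succ p ih =>
    have e1 : i + 1 + p = i + p + 1 := by omega
    have e2 : i + 1 + p + 1 = i + p + 2 := by omega
    rw [bspline_succ, bspline_succ]
    -- If exactly the inner `p + 1` knots equal `x`, both B-splines of degree `p` jump there, one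
    -- from 1 to 0 and the other from 0 to 1. Both weights are 1 at `x`, so the jumps cancel.
    by_cases hE : ξ (i + 1) = x ∧ ξ (i + p + 1) = x
    · have hi : ξ i < x := lt_of_le_of_ne (hE.1 ▸ hξ (by omega)) fun h => h1 ⟨h, hE.2⟩
      have hi' : x < ξ (i + p + 2) := lt_of_le_of_ne (hE.2 ▸ hξ (by omega))
        fun h => h2 ⟨hE.1, h.symm⟩
      rw [bspline_eq_zero_of_before (b := b) (i := i) hξ ((hR _).2 hE.2.le),
        bspline_eq_zero_of_not_before (b := x) (i := i + 1) hξ (fun h => ((hL _).1 h).ne hE.1),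
        bspline_eq_one_of_run_end (b := x) (i := i) hξ ((hL _).2 hi)
          (fun h => ((hL _).1 h).ne hE.1) hE.1 hE.2,
        bspline_eq_one_of_run_start (b := b) (i := i + 1) hξ ((hR _).2 (by rw [e1]; exact hE.2.le))
          (fun h => absurd ((hR _).1 h) (by rw [e2]; exact not_le.2 hi')) hE.1 (by rw [e1]; exact hE.2),
        hE.1, hE.2, div_self (sub_ne_zero.2 hi.ne'), div_self (sub_ne_zero.2 hi'.ne')]
      simp
    · congr 1
      -- Otherwise, a B-spline of degree `p` that may jump at `x` is multiplied by a weight that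
      -- vanishes there.
      · by_cases h : ξ i = x ∧ ξ (i + p) = x
        · rw [h.1]; simp
        · rw [ih h hE]
      · by_cases h : ξ (i + 1 + 1) = x ∧ ξ (i + 1 + p + 1) = x
        · rw [e2] at h
          rw [h.2]; simp
        · rw [ih (by rwa [e1]) h]

/-- Local linear independence of the B-splines. -/
theorem eq_zero_of_sum_bspline_eq_zero (hξ : Monotone ξ) {p m : ℕ} (h1 : ξ (m + p) < ξ (m + p + 1))
    (h2 : ξ (m + p + 1) ≤ b) {c : ℕ → ℝ}
    (h : ∀ x ∈ Ico (ξ (m + p)) (ξ (m + p + 1)),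
      ∑ r ∈ Finset.range (p + 1), c r * bspline b ξ p (m + r) x = 0) :
    ∀ r ≤ p, c r = 0 := by
  induction p generalizing m c with
  | zero =>
    intro r hr
    have h3 := h (ξ m) ⟨le_rfl, h1⟩
    have hb : ξ m < b := lt_of_lt_of_le h1 h2
    rw [Finset.sum_range_one, bspline_zero, if_pos, mul_one] at h3
    · rwa [Nat.le_zero.1 hr]
    · exact ⟨(before_iff_of_lt hb).2 le_rfl, fun h4 => absurd ((before_iff_of_lt hb).1 h4) (not_le.2 h1)⟩
  | succ p ih =>
    -- Differentiating the vanishing sum gives a vanishing sum one degree lower, whose coefficients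
    -- are the divided differences of `c`.
    have key : ∀ r ≤ p, (c (r + 1) - c r) / (ξ (m + 1 + r + p + 1) - ξ (m + 1 + r)) = 0 := by
      have e : m + 1 + p = m + (p + 1) := by omega
      refine ih (m := m + 1) (c := fun r => (c (r + 1) - c r) /
        (ξ (m + 1 + r + p + 1) - ξ (m + 1 + r))) (by rwa [e]) (by rwa [e]) fun x hx => ?_
      rw [e] at hx
      have hxb : x < b := hx.2.trans_le h2
      have hd : HasDerivWithinAt (fun y => ∑ r ∈ Finset.range (p + 1 + 1),
          c r * bspline b ξ (p + 1) (m + r) y) _ (Ici x) x :=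
        HasDerivWithinAt.fun_sum fun r _ =>
          (hasDerivWithinAt_bspline hξ hxb (p + 1) (m + r)).const_mul (c r)
      have h0 : HasDerivWithinAt (fun y => ∑ r ∈ Finset.range (p + 1 + 1),
          c r * bspline b ξ (p + 1) (m + r) y) 0 (Ici x) x := by
        refine (hasDerivWithinAt_const x (Ici x) (0 : ℝ)).congr_of_eventuallyEq ?_ (h x hx)
        have hlt : ∀ᶠ y in 𝓝[≥] x, y < ξ (m + (p + 1) + 1) :=
          (eventually_lt_nhds hx.2).filter_mono nhdsWithin_le_nhds
        filter_upwards [hlt, self_mem_nhdsWithin] with y hy hy'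
        exact h y ⟨hx.1.trans hy', hy⟩
      have h5 := (uniqueDiffWithinAt_Ici x).eq_deriv _ hd h0
      have z1 : bspline b ξ p (m + 0) x = 0 :=
        bspline_eq_zero_of_before hξ ((before_iff_of_lt hxb).2 hx.1)
      have z2 : bspline b ξ p (m + (p + 1) + 1) x = 0 :=
        bspline_eq_zero_of_not_before hξ fun h6 =>
          absurd ((before_iff_of_lt hxb).1 h6) (not_le.2 hx.2)
      simp only [Nat.add_sub_cancel, mul_sub, Finset.sum_sub_distrib] at h5
      rw [Finset.sum_range_succ', Finset.sum_range_succ _ (p + 1), z1, z2] at h5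
      simp only [zero_div, mul_zero, add_zero] at h5
      rw [← Finset.sum_sub_distrib] at h5
      have hp : ((p + 1 : ℕ) : ℝ) ≠ 0 := by positivity
      apply mul_left_cancel₀ hp
      rw [mul_zero, ← h5, Finset.mul_sum]
      refine Finset.sum_congr rfl fun r _ => ?_
      rw [show m + (r + 1) + (p + 1) = m + 1 + r + p + 1 by omega,
        show m + r + (p + 1) + 1 = m + 1 + r + p + 1 by omega,
        show m + (r + 1) = m + 1 + r by omega, show m + r + 1 = m + 1 + r by omega]
      ring
    -- The knot interval has positive length and lies in the supports in question, so the
    -- denominators do not vanish and `c` is constant. The partition of unity then forces the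
    -- constant to be zero.
    have hc : ∀ r ≤ p + 1, c r = c 0 := by
      intro r hr
      induction r with
      | zero => rfl
      | succ r ihr =>
        have h3 : ξ (m + 1 + r) < ξ (m + 1 + r + p + 1) :=
          lt_of_le_of_lt (hξ (by omega)) (h1.trans_le (hξ (by omega)))
        rcases div_eq_zero_iff.1 (key r (by omega)) with h4 | h4
        · rw [sub_eq_zero.1 h4, ihr (by omega)]
        · exact absurd (sub_eq_zero.1 h4) h3.ne'
    have hb : ξ (m + (p + 1)) < b := h1.trans_le h2
    have h6 := h _ ⟨le_rfl, h1⟩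
    rw [Finset.sum_congr rfl fun r hr => by
        rw [hc r (Nat.lt_succ_iff.1 (Finset.mem_range.1 hr))], ← Finset.mul_sum,
      sum_bspline hξ ((before_iff_of_lt hb).2 le_rfl)
        (fun h7 => absurd ((before_iff_of_lt hb).1 h7) (not_le.2 h1)), mul_one] at h6
    intro r hr
    rw [hc r hr, h6]

end Monotone

/-! ### Knot insertion -/

/-- The coefficient of `B_{i,p}` in the expansion of the `i`-th B-spline without the knot `ξ i₀`. -/
noncomputable def insertWeight (p : ℕ) (ξ : ℕ → ℝ) (i₀ i : ℕ) : ℝ :=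
  if i + p + 1 < i₀ then 1 else if i₀ ≤ i then 0 else (ξ i₀ - ξ i) / (ξ (i + p + 1) - ξ i)

/-- The control points after the insertion of the knot `ξ i₀`. -/
noncomputable def insertCoeff (p : ℕ) (ξ : ℕ → ℝ) (i₀ : ℕ) (c : ℕ → ℝ) (i : ℕ) : ℝ :=
  insertWeight p ξ i₀ i * c i + (1 - insertWeight p ξ i₀ i) * c (i - 1)

theorem bspline_removeKnot_of_lt {b x : ℝ} {ξ : ℕ → ℝ} {p i₀ i : ℕ} (h : i + p + 1 < i₀) :
    bspline b (removeKnot i₀ ξ) p i x = bspline b ξ p i x :=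
  bspline_congr (fun j _ h2 => if_pos (by omega)) x

theorem bspline_removeKnot_of_le {b x : ℝ} {ξ : ℕ → ℝ} {p i₀ i : ℕ} (h : i₀ ≤ i) :
    bspline b (removeKnot i₀ ξ) p i x = bspline b ξ p (i + 1) x := by
  rw [← bspline_shift]
  exact bspline_congr (fun j h1 _ => if_neg (by omega)) x

/-- Boehm's formula, by induction on the degree: expand the coarse B-spline by its recursion, apply
the formula in lower degree, and compare coefficients of the fine B-splines of degree `p`. -/
theorem bspline_removeKnot_of_mem {b x : ℝ} {ξ : ℕ → ℝ} (hξ : Monotone ξ) {p i₀ i : ℕ}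
    (h1 : i < i₀) (h2 : i₀ ≤ i + p + 1) :
    bspline b (removeKnot i₀ ξ) p i x
      = (ξ i₀ - ξ i) / (ξ (i + p + 1) - ξ i) * bspline b ξ p i x
        + (ξ (i + p + 2) - ξ i₀) / (ξ (i + p + 2) - ξ (i + 1)) * bspline b ξ p (i + 1) x := by
  induction p generalizing i with
  | zero =>
    obtain rfl : i₀ = i + 1 := by omega
    classical
    simp only [bspline_zero, removeKnot]
    simp only [lt_add_iff_pos_right, zero_lt_one, if_true, lt_self_iff_false, if_false, add_zero]
    have m1 : ξ i ≤ ξ (i + 1) := hξ (by omega)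
    have m2 : ξ (i + 1) ≤ ξ (i + 2) := hξ (by omega)
    by_cases p0 : Before b x (ξ i)
    · by_cases p1 : Before b x (ξ (i + 1))
      · by_cases p2 : Before b x (ξ (i + 2))
        · simp [p1, p2]
        · have : ξ (i + 2) - ξ (i + 1) ≠ 0 := by
            intro h; rw [sub_eq_zero.1 h] at p2; exact p2 p1
          simp [p0, p1, p2, div_self this]
      · have p2 : ¬ Before b x (ξ (i + 2)) := fun h => p1 (h.mono m2)
        have : ξ (i + 1) - ξ i ≠ 0 := by
          intro h; rw [sub_eq_zero.1 h] at p1; exact p1 p0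
        simp [p0, p1, p2, div_self this]
    · have p1 : ¬ Before b x (ξ (i + 1)) := fun h => p0 (h.mono m1)
      simp [p0, p1]
  | succ p ih =>
    have k0 : removeKnot i₀ ξ i = ξ i := if_pos h1
    have k3 : removeKnot i₀ ξ (i + p + 2) = ξ (i + p + 3) := if_neg (by omega)
    rw [bspline_succ, bspline_succ b ξ p i, bspline_succ b ξ p (i + 1), k0, k3]
    simp only [show i + 1 + p + 2 = i + p + 3 by omega, show i + 1 + p + 1 = i + p + 2 by omega,
      show i + (p + 1) + 2 = i + p + 3 by omega, show i + (p + 1) + 1 = i + p + 2 by omega,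
      show i + 1 + 1 = i + 2 by omega]
    have d1 : ξ i ≤ ξ (i + 1) := hξ (by omega)
    have d2 : ξ (i + 1) ≤ ξ (i + p + 2) := hξ (by omega)
    have d3 : ξ (i + p + 2) ≤ ξ (i + p + 3) := hξ (by omega)
    -- The coefficient of the middle B-spline is symmetric in the evaluation point `x` and the
    -- inserted knot `t`.
    have hmid : ∀ M t : ℝ, (x - ξ i) / (ξ (i + p + 2) - ξ i)
          * ((ξ (i + p + 2) - t) / (ξ (i + p + 2) - ξ (i + 1)) * M)
        + (ξ (i + p + 3) - x) / (ξ (i + p + 3) - ξ (i + 1))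
          * ((t - ξ (i + 1)) / (ξ (i + p + 2) - ξ (i + 1)) * M)
        = (t - ξ i) / (ξ (i + p + 2) - ξ i)
          * ((ξ (i + p + 2) - x) / (ξ (i + p + 2) - ξ (i + 1)) * M)
        + (ξ (i + p + 3) - t) / (ξ (i + p + 3) - ξ (i + 1))
          * ((x - ξ (i + 1)) / (ξ (i + p + 2) - ξ (i + 1)) * M) := by
      intro M t
      rcases d2.eq_or_lt with h | h
      · simp [h]
      · have n1 : ξ (i + p + 2) - ξ (i + 1) ≠ 0 := (sub_pos.2 h).ne'
        have n2 : ξ (i + p + 2) - ξ i ≠ 0 := (sub_pos.2 (d1.trans_lt h)).ne'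
        have n3 : ξ (i + p + 3) - ξ (i + 1) ≠ 0 := (sub_pos.2 (h.trans_le d3)).ne'
        field_simp
        ring
    rcases eq_or_lt_of_le h2 with h3 | h3
    · -- the inserted knot is the last one
      have e : i₀ = i + p + 2 := by omega
      subst e
      have k1 : removeKnot (i + p + 2) ξ (i + p + 1) = ξ (i + p + 1) := if_pos (by omega)
      have k2 : removeKnot (i + p + 2) ξ (i + 1) = ξ (i + 1) := if_pos (by omega)
      rw [bspline_removeKnot_of_lt (by omega), ih (i := i + 1) (by omega) (by omega), k1, k2]
      simp only [show i + 1 + p + 2 = i + p + 3 by omega, show i + 1 + p + 1 = i + p + 2 by omega,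
        show i + 1 + 1 = i + 2 by omega]
      have hm := hmid (bspline b ξ p (i + 1) x) (ξ (i + p + 2))
      have hM : (x - ξ i) / (ξ (i + p + 1) - ξ i) * bspline b ξ p i x
          = (ξ (i + p + 2) - ξ i) / (ξ (i + p + 2) - ξ i)
            * ((x - ξ i) / (ξ (i + p + 1) - ξ i) * bspline b ξ p i x) := by
        by_cases h : ξ (i + p + 2) - ξ i = 0
        · have : ξ (i + p + 1) = ξ i :=
            le_antisymm (by rw [← sub_eq_zero.1 h]; exact hξ (by omega)) (hξ (by omega))
          simp [this]
        · rw [div_self h, one_mul]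
      simp only [sub_self, zero_div, zero_mul, mul_zero, zero_add] at hm
      linear_combination hM + hm
    · rcases eq_or_lt_of_le (Nat.succ_le_of_lt h1) with h4 | h4
      · -- the inserted knot is the first one
        have e : i₀ = i + 1 := by omega
        subst e
        have k1 : removeKnot (i + 1) ξ (i + p + 1) = ξ (i + p + 2) := if_neg (by omega)
        have k2 : removeKnot (i + 1) ξ (i + 1) = ξ (i + 2) := if_neg (by omega)
        rw [bspline_removeKnot_of_le (i := i + 1) (by omega), ih (by omega) (by omega), k1, k2]
        have hm := hmid (bspline b ξ p (i + 1) x) (ξ (i + 1))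
        have hM : (ξ (i + p + 3) - x) / (ξ (i + p + 3) - ξ (i + 2)) * bspline b ξ p (i + 2) x
            = (ξ (i + p + 3) - ξ (i + 1)) / (ξ (i + p + 3) - ξ (i + 1))
              * ((ξ (i + p + 3) - x) / (ξ (i + p + 3) - ξ (i + 2)) * bspline b ξ p (i + 2) x) := by
          by_cases h : ξ (i + p + 3) - ξ (i + 1) = 0
          · have : ξ (i + 2) = ξ (i + p + 3) :=
              le_antisymm (hξ (by omega)) (by rw [sub_eq_zero.1 h]; exact hξ (by omega))
            simp [this]
          · rw [div_self h, one_mul]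
        simp only [sub_self, zero_div, zero_mul, mul_zero, add_zero] at hm
        rw [show i + 1 + 1 = i + 2 by omega]
        linear_combination hM + hm
      · have k1 : removeKnot i₀ ξ (i + p + 1) = ξ (i + p + 2) := if_neg (by omega)
        have k2 : removeKnot i₀ ξ (i + 1) = ξ (i + 1) := if_pos (by omega)
        rw [ih h1 (by omega), ih (i := i + 1) h4 (by omega), k1, k2]
        simp only [show i + 1 + p + 2 = i + p + 3 by omega,
          show i + 1 + p + 1 = i + p + 2 by omega, show i + 1 + 1 = i + 2 by omega]
        linear_combination hmid (bspline b ξ p (i + 1) x) (ξ i₀)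

/-- One formula for all positions of the knot relative to the support. The two quotients of Boehm's
formula are complementary weights except on degenerate supports, where the B-spline is zero. -/
theorem bspline_removeKnot {b x : ℝ} {ξ : ℕ → ℝ} (hξ : Monotone ξ) (p i₀ i : ℕ) :
    bspline b (removeKnot i₀ ξ) p i x = insertWeight p ξ i₀ i * bspline b ξ p i x
      + (1 - insertWeight p ξ i₀ (i + 1)) * bspline b ξ p (i + 1) x := by
  have e : i + 1 + p + 1 = i + p + 2 := by omega
  have hone : (ξ (i + p + 2) - ξ (i + 1)) /
      (ξ (i + p + 2) - ξ (i + 1)) * bspline b ξ p (i + 1) x = bspline b ξ p (i + 1) x := by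
    by_cases h : ξ (i + p + 2) - ξ (i + 1) = 0
    · rw [bspline_eq_zero_of_eq hξ (i := i + 1) (by rw [e]; exact sub_eq_zero.1 h), mul_zero]
    · rw [div_self h, one_mul]
  rcases lt_or_ge (i + p + 1) i₀ with h1 | h1
  · rw [bspline_removeKnot_of_lt h1]
    have w1 : insertWeight p ξ i₀ i = 1 := if_pos h1
    rcases eq_or_lt_of_le (Nat.succ_le_of_lt h1) with h2 | h2
    · obtain rfl : i₀ = i + p + 2 := by omega
      have w2 : insertWeight p ξ (i + p + 2) (i + 1)
          = (ξ (i + p + 2) - ξ (i + 1)) / (ξ (i + p + 2) - ξ (i + 1)) := by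
        unfold insertWeight
        rw [if_neg (by omega), if_neg (by omega), e]
      rw [w1, w2]
      linear_combination hone
    · have w2 : insertWeight p ξ i₀ (i + 1) = 1 := if_pos (by omega)
      rw [w1, w2]; ring
  · rcases le_or_gt i₀ i with h2 | h2
    · have w1 : insertWeight p ξ i₀ i = 0 := by
        unfold insertWeight; rw [if_neg (by omega), if_pos h2]
      have w2 : insertWeight p ξ i₀ (i + 1) = 0 := by
        unfold insertWeight; rw [if_neg (by omega), if_pos (by omega)]
      rw [bspline_removeKnot_of_le h2, w1, w2]; ring
    · have w1 : insertWeight p ξ i₀ i = (ξ i₀ - ξ i) / (ξ (i + p + 1) - ξ i) := by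
        unfold insertWeight; rw [if_neg (by omega), if_neg (by omega)]
      rw [bspline_removeKnot_of_mem hξ h2 h1, w1]
      congr 1
      rcases eq_or_lt_of_le (Nat.succ_le_of_lt h2) with h3 | h3
      · obtain rfl : i₀ = i + 1 := by omega
        have w2 : insertWeight p ξ (i + 1) (i + 1) = 0 := by
          unfold insertWeight; rw [if_neg (by omega), if_pos le_rfl]
        rw [w2, hone, sub_zero, one_mul]
      · have w2 : insertWeight p ξ i₀ (i + 1)
            = (ξ i₀ - ξ (i + 1)) / (ξ (i + p + 2) - ξ (i + 1)) := by
          unfold insertWeight; rw [if_neg (by omega), if_neg (by omega), e]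
        rw [w2]
        by_cases h : ξ (i + p + 2) - ξ (i + 1) = 0
        · rw [bspline_eq_zero_of_eq hξ (i := i + 1) (by rw [e]; exact sub_eq_zero.1 h), mul_zero,
            mul_zero]
        · congr 1
          field_simp
          ring

/-! ### Splines -/

/-- A knot vector constrains finitely many indices, while the lemmas on B-splines ask for a monotone
sequence. Clamping the index reconciles the two. -/
theorem exists_monotone_extension {N : ℕ} {ξ : ℕ → ℝ} (hN : 1 ≤ N)
    (h : ∀ i j, 1 ≤ i → i ≤ j → j ≤ N → ξ i ≤ ξ j) :
    ∃ η : ℕ → ℝ, Monotone η ∧ ∀ i, 1 ≤ i → i ≤ N → ξ i = η i := by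
  refine ⟨fun i => ξ (max 1 (min i N)), fun i j hij => h _ _ (by omega) (by omega) (by omega),
    fun i h1 h2 => ?_⟩
  show ξ i = ξ _
  congr 1
  omega

theorem spline_congr {p n : ℕ} {ξ η c d : ℕ → ℝ} (h : ∀ i, 1 ≤ i → i ≤ n + p + 1 → ξ i = η i)
    (hc : ∀ i, 1 ≤ i → i ≤ n → c i = d i) (x : ℝ) : spline p n ξ c x = spline p n η d x := by
  unfold spline
  refine Finset.sum_congr rfl fun i hi => ?_
  rw [Finset.mem_Icc] at hi
  rw [hc i hi.1 hi.2, h (n + 1) (by omega) (by omega),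
    bspline_congr fun j h1 h2 => h j (by omega) (by omega)]

theorem spline_eq_sum_range (p n : ℕ) (ξ c : ℕ → ℝ) (x : ℝ) :
    spline p n ξ c x
      = ∑ r ∈ Finset.range n, c (1 + r) * bspline (ξ (n + 1)) ξ p (1 + r) x := by
  unfold spline
  rw [show Finset.Icc 1 n = Finset.Ico 1 (n + 1) from rfl, Finset.sum_Ico_eq_sum_range,
    Nat.add_sub_cancel]

theorem spline_sub (p n : ℕ) (ξ c d : ℕ → ℝ) (x : ℝ) :
    spline p n ξ c x - spline p n ξ d x = spline p n ξ (fun i => c i - d i) x := by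
  unfold spline
  rw [← Finset.sum_sub_distrib]
  exact Finset.sum_congr rfl fun i _ => by ring

theorem insertWeight_congr {p n i₀ : ℕ} {ξ η : ℕ → ℝ}
    (h : ∀ i, 1 ≤ i → i ≤ n + p + 1 → ξ i = η i) {i : ℕ} (h1 : 1 ≤ i) (h2 : i ≤ n) :
    insertWeight p ξ i₀ i = insertWeight p η i₀ i := by
  unfold insertWeight
  split_ifs
  · rfl
  · rfl
  · rw [h i₀ (by omega) (by omega), h i (by omega) (by omega), h (i + p + 1) (by omega) (by omega)]

theorem spline_removeKnot {p n i₀ : ℕ} {ξ : ℕ → ℝ}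
    (hξ : ∀ i j, 1 ≤ i → i ≤ j → j ≤ n + p + 1 → ξ i ≤ ξ j) (h1 : p + 2 ≤ i₀) (h2 : i₀ ≤ n)
    (c : ℕ → ℝ) (x : ℝ) :
    spline p (n - 1) (removeKnot i₀ ξ) c x = spline p n ξ (insertCoeff p ξ i₀ c) x := by
  obtain ⟨n, rfl⟩ : ∃ k, n = k + 1 := ⟨n - 1, by omega⟩
  obtain ⟨η, hη, he⟩ := exists_monotone_extension (by omega) hξ
  have r1 : ∀ i, 1 ≤ i → i ≤ n + p + 1 → removeKnot i₀ ξ i = removeKnot i₀ η i := by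
    intro i hi hi'
    unfold removeKnot
    split_ifs
    · exact he i hi (by omega)
    · exact he (i + 1) (by omega) (by omega)
  have r2 : ∀ i, 1 ≤ i → i ≤ n + 1 → insertCoeff p ξ i₀ c i = insertCoeff p η i₀ c i := by
    intro i hi hi'
    unfold insertCoeff
    rw [insertWeight_congr he hi hi']
  rw [Nat.add_sub_cancel, spline_congr r1 (fun _ _ _ => rfl), spline_congr he r2,
    spline_eq_sum_range, spline_eq_sum_range]
  have hb : removeKnot i₀ η (n + 1) = η (n + 1 + 1) := if_neg (by omega)
  rw [hb]
  set b := η (n + 1 + 1)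
  simp only [bspline_removeKnot hη, insertCoeff, add_mul, mul_add, Finset.sum_add_distrib]
  -- The sum over the fine B-splines contains `c 0` and `c (n + 1)`, which are not control points of
  -- the coarse spline; `z1` and `z2` show that they do not contribute.
  have z1 : (1 - insertWeight p η i₀ (1 + 0)) * c (1 + 0 - 1) * bspline b η p (1 + 0) x = 0 := by
    rcases eq_or_lt_of_le h1 with h3 | h3
    · subst h3
      have w : insertWeight p η (p + 2) 1 = (η (p + 2) - η 1) / (η (p + 2) - η 1) := by
        unfold insertWeight
        rw [if_neg (by omega), if_neg (by omega), show 1 + p + 1 = p + 2 by omega]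
      by_cases h : η (p + 2) - η 1 = 0
      · rw [bspline_eq_zero_of_eq hη (i := 1 + 0), mul_zero]
        rw [show 1 + 0 + p + 1 = p + 2 by omega]
        exact sub_eq_zero.1 h
      · rw [add_zero, w, div_self h]; ring
    · have w : insertWeight p η i₀ (1 + 0) = 1 := if_pos (by omega)
      rw [w]; ring
  have z2 : insertWeight p η i₀ (1 + n) * c (1 + n) * bspline b η p (1 + n) x = 0 := by
    have w : insertWeight p η i₀ (1 + n) = 0 := by
      unfold insertWeight; rw [if_neg (by omega), if_pos (by omega)]
    rw [w]; ring
  rw [Finset.sum_range_succ, z2, Finset.sum_range_succ', z1, add_zero, add_zero]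
  congr 1
  · exact Finset.sum_congr rfl fun r _ => by ring
  · refine Finset.sum_congr rfl fun r _ => ?_
    rw [show 1 + (r + 1) - 1 = 1 + r by omega, show 1 + (r + 1) = 1 + r + 1 by omega]
    ring

/-! ### Bounds from the partition of unity, and end point values -/

theorem IsBasicKnotVector.lt {p n : ℕ} {ξ : ℕ → ℝ} (h : IsBasicKnotVector p n ξ) :
    ξ (p + 1) < ξ (n + 1) :=
  h.left.trans_le (h.mono _ _ (by omega) (by have := h.dim; omega) (by omega))

theorem before_of_mem_Icc {a b x : ℝ} (hab : a < b) (hx : x ∈ Icc a b) : Before b x a := by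
  rcases hx.1.eq_or_lt with h | h
  · exact Or.inr ⟨h, h ▸ hab⟩
  · exact Or.inl h

theorem not_before_of_le {b x : ℝ} (hx : x ≤ b) : ¬ Before b x b := by
  rintro (h | ⟨h, h'⟩)
  · exact absurd h (not_lt.2 hx)
  · exact absurd h h'.ne'

/-- Jensen's inequality for the partition of unity by B-splines. -/
theorem spline_sq_le {p n : ℕ} {ξ : ℕ → ℝ} (h : IsBasicKnotVector p n ξ) (d : ℕ → ℝ) {x : ℝ}
    (hx : x ∈ Icc (ξ (p + 1)) (ξ (n + 1))) :
    spline p n ξ d x ^ 2 ≤ spline p n ξ (fun i => d i ^ 2) x := by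
  obtain ⟨η, hη, he⟩ := exists_monotone_extension (by omega) h.mono
  have hab := h.lt
  rw [he (p + 1) (by omega) (by have := h.dim; omega), he (n + 1) (by omega) (by omega)] at hx hab
  rw [spline_congr he (fun _ _ _ => rfl), spline_congr he (fun _ _ _ => rfl),
    spline_eq_sum_range, spline_eq_sum_range]
  have h1 := sum_bspline (b := η (n + 1)) hη (p := p) (m := 1) (N := n)
    (by rw [add_comm 1 p]; exact before_of_mem_Icc hab hx)
    (by rw [add_comm 1 n]; exact not_before_of_le hx.2)
  have h2 := Finset.sum_sq_le_sum_mul_sum_of_sq_le_mul (Finset.range n)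
    (r := fun r => d (1 + r) * bspline (η (n + 1)) η p (1 + r) x)
    (f := fun r => d (1 + r) ^ 2 * bspline (η (n + 1)) η p (1 + r) x)
    (g := fun r => bspline (η (n + 1)) η p (1 + r) x)
    (fun r _ => mul_nonneg (sq_nonneg _) (bspline_nonneg hη _ _))
    (fun r _ => bspline_nonneg hη _ _) (fun r _ => le_of_eq (by ring))
  rwa [h1, mul_one] at h2

theorem spline_le_of_le {p n : ℕ} {ξ : ℕ → ℝ} (h : IsBasicKnotVector p n ξ) {c : ℕ → ℝ} {C x : ℝ}
    (hx : x ∈ Icc (ξ (p + 1)) (ξ (n + 1))) (hc : ∀ i, 1 ≤ i → i ≤ n → c i ≤ C) :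
    spline p n ξ c x ≤ C := by
  obtain ⟨η, hη, he⟩ := exists_monotone_extension (by omega) h.mono
  have hab := h.lt
  rw [he (p + 1) (by omega) (by have := h.dim; omega), he (n + 1) (by omega) (by omega)] at hx hab
  rw [spline_congr he (fun _ _ _ => rfl), spline_eq_sum_range]
  have h1 := sum_bspline (b := η (n + 1)) hη (p := p) (m := 1) (N := n)
    (by rw [add_comm 1 p]; exact before_of_mem_Icc hab hx)
    (by rw [add_comm 1 n]; exact not_before_of_le hx.2)
  rw [← mul_one C, ← h1, Finset.mul_sum]
  refine Finset.sum_le_sum fun r hr => mul_le_mul_of_nonneg_right (hc _ (by omega) ?_)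
    (bspline_nonneg hη _ _)
  have := Finset.mem_range.1 hr
  omega

theorem abs_spline_le {p n : ℕ} {ξ : ℕ → ℝ} (h : IsBasicKnotVector p n ξ) (c : ℕ → ℝ) :
    ∃ C, ∀ x ∈ Icc (ξ (p + 1)) (ξ (n + 1)), |spline p n ξ c x| ≤ C := by
  refine ⟨∑ i ∈ Finset.Icc 1 n, |c i|, fun x hx => ?_⟩
  refine abs_le_of_sq_le_sq ((spline_sq_le h c hx).trans (spline_le_of_le h hx fun i h1 h2 => ?_))
    (Finset.sum_nonneg fun _ _ => abs_nonneg _)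
  rw [← sq_abs]
  exact pow_le_pow_left₀ (abs_nonneg _) (Finset.single_le_sum (f := fun i => |c i|)
    (fun _ _ => abs_nonneg _) (Finset.mem_Icc.2 ⟨h1, h2⟩)) 2

/-- At the `(p + 1)`-fold first knot the first B-spline equals one; as the B-splines are nonnegative
with sum one, all others vanish. -/
theorem spline_left_endpoint {p n : ℕ} {ξ : ℕ → ℝ} (h : IsOpenKnotVector p n ξ) (c : ℕ → ℝ) :
    spline p n ξ c (ξ (p + 1)) = c 1 := by
  have hdim := h.dim
  obtain ⟨η, hη, he⟩ := exists_monotone_extension (by omega) h.mono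
  have hab := h.lt
  have hfirst := h.first 1 le_rfl (by omega)
  have hleft := h.left
  rw [he 1 le_rfl (by omega), he (p + 1) (by omega) (by omega)] at hfirst
  rw [he (p + 1) (by omega) (by omega), he (p + 2) (by omega) (by omega)] at hleft
  rw [he (p + 1) (by omega) (by omega), he (n + 1) (by omega) (by omega)] at hab
  rw [spline_congr he (fun _ _ _ => rfl), spline_eq_sum_range,
    he (p + 1) (by omega) (by omega)]
  have h1 := sum_bspline (b := η (n + 1)) (x := η (p + 1)) hη (p := p) (m := 1) (N := n)
    (by rw [add_comm 1 p]; exact before_of_mem_Icc hab ⟨le_rfl, hab.le⟩)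
    (by rw [add_comm 1 n]; exact not_before_of_le hab.le)
  have e : 1 + p = p + 1 := by omega
  have h2 : bspline (η (n + 1)) η p (1 + 0) (η (p + 1)) = 1 :=
    bspline_eq_one_of_run_start hη (by rw [add_zero, e]; exact (before_iff_of_lt hab).2 le_rfl)
      (by
        rw [add_zero, e]
        exact fun h3 => absurd ((before_iff_of_lt hab).1 h3) (not_le.2 hleft))
      hfirst (by rw [add_zero, e])
  obtain ⟨n, rfl⟩ : ∃ k, n = k + 1 := ⟨n - 1, by omega⟩
  rw [Finset.sum_range_succ', h2] at h1 ⊢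
  have h3 := (Finset.sum_eq_zero_iff_of_nonneg (fun r _ => bspline_nonneg hη p _)).1
    (show ∑ r ∈ Finset.range n, bspline (η (n + 1 + 1)) η p (1 + (r + 1)) (η (p + 1)) = 0 by
      linarith)
  rw [Finset.sum_eq_zero fun r hr => by rw [h3 r hr, mul_zero]]
  simp

/-! ### Derivatives, continuity and linear independence of splines -/

theorem greville_succ_sub {p : ℕ} (ξ : ℕ → ℝ) (i : ℕ) :
    greville (p + 1) ξ (i + 1) - greville (p + 1) ξ i
      = (ξ (i + p + 2) - ξ (i + 1)) / ((p + 1 : ℕ) : ℝ) := by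
  unfold greville
  rw [← sub_div]
  congr 1
  have h : ∀ k, ∑ j ∈ Finset.Icc (k + 1) (k + (p + 1)), ξ j
      = ∑ r ∈ Finset.range (p + 1), ξ (k + 1 + r) := by
    intro k
    rw [show Finset.Icc (k + 1) (k + (p + 1)) = Finset.Ico (k + 1) (k + (p + 1) + 1) from rfl,
      Finset.sum_Ico_eq_sum_range, show k + (p + 1) + 1 - (k + 1) = p + 1 by omega]
  rw [h, h, Finset.sum_range_succ, Finset.sum_range_succ' _ p,
    Finset.sum_congr rfl fun r _ => by rw [show i + 1 + 1 + r = i + 1 + (r + 1) by omega],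
    show i + 1 + 1 + p = i + p + 2 by omega, add_zero]
  ring

theorem derivCoeff_succ {p : ℕ} (ξ c : ℕ → ℝ) (i : ℕ) :
    derivCoeff (p + 1) ξ c i
      = ((p + 1 : ℕ) : ℝ) * ((c (i + 1) - c i) / (ξ (i + p + 2) - ξ (i + 1))) := by
  unfold derivCoeff
  rw [greville_succ_sub, div_div_eq_mul_div]
  ring

/-- Summation by parts turns the differences of B-splines into differences of control points. -/
theorem hasDerivWithinAt_spline {p n : ℕ} {ξ : ℕ → ℝ} (h : IsOpenKnotVector (p + 1) n ξ)
    (c : ℕ → ℝ) {x : ℝ} (hx : x < ξ (n + 1)) :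
    HasDerivWithinAt (spline (p + 1) n ξ c)
      (spline p (n - 1) (derivKnots ξ) (derivCoeff (p + 1) ξ c) x) (Ici x) x := by
  have hdim := h.dim
  obtain ⟨n, rfl⟩ : ∃ k, n = k + 1 := ⟨n - 1, by omega⟩
  obtain ⟨η, hη, he⟩ := exists_monotone_extension (by omega) h.mono
  -- The end knots are repeated, so the two boundary terms have denominator zero and drop out.
  have z1 : η (p + 2) - η 1 = 0 := by
    rw [← he _ (by omega) (by omega), ← he _ (by omega) (by omega), sub_eq_zero]
    exact (h.first 1 le_rfl (by omega)).symm
  have z2 : η (n + p + 3) - η (n + 2) = 0 := by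
    rw [← he _ (by omega) (by omega), ← he _ (by omega) (by omega), sub_eq_zero]
    exact h.last (n + p + 3) (by omega) (by omega)
  rw [he (n + 1 + 1) (by omega) (by omega)] at hx
  have hd : ∀ i, 1 ≤ i → i ≤ n →
      derivCoeff (p + 1) ξ c i = derivCoeff (p + 1) η c i := by
    intro i h1 h2
    rw [derivCoeff_succ, derivCoeff_succ, he _ (by omega) (by omega), he _ (by omega) (by omega)]
  rw [Nat.add_sub_cancel, spline_congr (ξ := derivKnots ξ) (η := derivKnots η) (fun i h1 h2 => he (i + 1) (by omega)
    (by omega)) hd, funext (spline_congr he (fun i _ _ => rfl)), spline_eq_sum_range,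
    funext (spline_eq_sum_range (p + 1) (n + 1) η c)]
  have hs : ∀ i, bspline (derivKnots η (n + 1)) (derivKnots η) p i x
      = bspline (η (n + 1 + 1)) η p (i + 1) x := fun i => bspline_shift _ _ _ _ _ _
  simp only [hs, derivCoeff_succ]
  refine (HasDerivWithinAt.fun_sum fun r _ =>
    (hasDerivWithinAt_bspline hη hx (p + 1) (1 + r)).const_mul (c (1 + r))).congr_deriv ?_
  rw [Nat.add_sub_cancel]
  simp only [mul_sub, Finset.sum_sub_distrib]
  rw [Finset.sum_range_succ', Finset.sum_range_succ _ n,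
    show 1 + 0 + (p + 1) = p + 2 by omega, show 1 + n + (p + 1) + 1 = n + p + 3 by omega,
    show 1 + n + 1 = n + 2 by omega, z1, z2]
  simp only [div_zero, mul_zero, add_zero]
  rw [← Finset.sum_sub_distrib]
  refine Finset.sum_congr rfl fun r _ => ?_
  rw [show 1 + (r + 1) + (p + 1) = 1 + r + p + 2 by omega,
    show 1 + r + (p + 1) + 1 = 1 + r + p + 2 by omega, show 1 + (r + 1) = 1 + r + 1 by omega]
  ring

/-- Continuity from the right follows from the right derivative. From the left, the limit is the
value under the left continuous convention, which agrees with the spline when no `p + 2` consecutive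
knots equal the point. -/
theorem continuousOn_spline {p n : ℕ} {ξ : ℕ → ℝ} (h : IsOpenKnotVector (p + 1) n ξ)
    (hr : ∀ i, p + 3 ≤ i → i + (p + 1) ≤ n → ξ i < ξ (i + (p + 1))) (c : ℕ → ℝ) :
    ContinuousOn (spline (p + 1) n ξ c) (Icc (ξ (p + 2)) (ξ (n + 1))) := by
  intro x hx
  have hdim := h.dim
  have hright : x < ξ (n + 1) → ContinuousWithinAt (spline (p + 1) n ξ c) (Ici x) x :=
    fun h1 => (hasDerivWithinAt_spline h c h1).continuousWithinAt
  have hleft : ξ (p + 2) < x → ContinuousWithinAt (spline (p + 1) n ξ c) (Iic x) x := by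
    intro h1
    rw [← continuousWithinAt_sdiff_self, Iic_sdiff_right]
    obtain ⟨η, hη, he⟩ := exists_monotone_extension (by omega) h.mono
    have hs : spline (p + 1) n ξ c = spline (p + 1) n η c :=
      funext (spline_congr he fun _ _ _ => rfl)
    rw [he (p + 2) (by omega) (by omega)] at h1
    have hx2 := hx.2
    rw [he (n + 1) (by omega) (by omega)] at hx2
    rw [hs]
    have hlim : Tendsto (spline (p + 1) n η c) (𝓝[<] x) (𝓝 (∑ i ∈ Finset.Icc 1 n,
        c i * bspline x η (p + 1) i x)) :=
      tendsto_finsetSum _ fun i _ => (tendsto_bspline_left η (p + 1) i).const_mul (c i)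
    suffices heq : spline (p + 1) n η c x
        = ∑ i ∈ Finset.Icc 1 n, c i * bspline x η (p + 1) i x by
      rwa [ContinuousWithinAt, heq]
    refine Finset.sum_congr rfl fun i hi => ?_
    rw [Finset.mem_Icc] at hi
    -- At `x = b` the spline is left continuous by definition.
    rcases hx2.eq_or_lt with h2 | h2
    · rw [← h2]
    · have hrun : ∀ i, 1 ≤ i → i + (p + 1) ≤ n + (p + 1) + 1 →
          ¬ (η i = x ∧ η (i + (p + 1)) = x) := by
        rintro i hi1 hi2 ⟨e1, e2⟩
        have b1 : p + 3 ≤ i := by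
          by_contra hc
          exact absurd (hη (show i ≤ p + 2 by omega)) (by rw [e1]; exact not_le.2 h1)
        have b2 : i + (p + 1) ≤ n := by
          by_contra hc
          exact absurd (hη (show n + 1 ≤ i + (p + 1) by omega)) (by rw [e2]; exact not_le.2 h2)
        have := hr i b1 b2
        rw [he i (by omega) (by omega), he _ (by omega) (by omega), e1, e2] at this
        exact lt_irrefl _ this
      rw [bspline_eq_left_limit hη h2 (hrun i hi.1 (by omega))]
      rw [show i + (p + 1) + 1 = i + 1 + (p + 1) by omega]
      exact hrun (i + 1) (by omega) (by omega)
  rcases hx.1.eq_or_lt with h1 | h1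
  · exact (hright (h1 ▸ h.lt)).mono fun y hy => h1 ▸ hy.1
  · rcases hx.2.eq_or_lt with h2 | h2
    · exact (hleft h1).mono fun y hy => h2 ▸ hy.2
    · exact ((hleft h1).union (hright h2)).mono fun y _ => le_total y x

theorem exists_lt_succ {ξ : ℕ → ℝ} {s e : ℕ} (hse : s ≤ e) (h : ξ s < ξ e) :
    ∃ j, s ≤ j ∧ j < e ∧ ξ j < ξ (j + 1) := by
  by_contra! hc
  have : ∀ k, s + k ≤ e → ξ (s + k) ≤ ξ s := by
    intro k
    induction k with
    | zero => intro _; exact le_rfl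
    | succ k ih => intro hk; exact (hc (s + k) (by omega) (by omega)).trans (ih (by omega))
  have h1 := this (e - s) (by omega)
  rw [Nat.add_sub_cancel' hse] at h1
  exact absurd h (not_lt.2 h1)

/-- Linear independence of the B-splines on `[a, b)`. -/
theorem coeff_eq_zero_of_spline_eq_zero {p n : ℕ} {ξ : ℕ → ℝ} (h : IsOpenKnotVector p n ξ)
    {c : ℕ → ℝ} (hc : ∀ x ∈ Ico (ξ (p + 1)) (ξ (n + 1)), spline p n ξ c x = 0) {i : ℕ} (h1 : 1 ≤ i)
    (h2 : i ≤ n) (hi : ξ i < ξ (i + p + 1)) : c i = 0 := by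
  have hdim := h.dim
  -- Because the knot vector is open, clamping the support to the indices of `[a, b]` does not
  -- change its end points. A nondegenerate support thus contains a nonempty knot interval inside
  -- `[a, b)`, where local independence applies.
  have hs : ξ (max i (p + 1)) = ξ i := by
    rcases le_total i (p + 1) with h3 | h3
    · rw [max_eq_right h3, h.first i h1 h3]
    · rw [max_eq_left h3]
  have he' : ξ (min (i + p + 1) (n + 1)) = ξ (i + p + 1) := by
    rcases le_total (i + p + 1) (n + 1) with h3 | h3
    · rw [min_eq_left h3]
    · rw [min_eq_right h3, h.last (i + p + 1) h3 (by omega)]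
  obtain ⟨j, hj1, hj2, hj⟩ := exists_lt_succ (ξ := ξ)
    (show max i (p + 1) ≤ min (i + p + 1) (n + 1) by omega) (by rwa [hs, he'])
  obtain ⟨η, hη, he⟩ := exists_monotone_extension (by omega) h.mono
  obtain ⟨m, rfl⟩ : ∃ m, j = m + p := ⟨j - p, by omega⟩
  obtain ⟨r, rfl⟩ : ∃ r, i = m + r := ⟨i - m, by omega⟩
  rw [he _ (by omega) (by omega), he _ (by omega) (by omega)] at hj
  have hb : η (m + p + 1) ≤ η (n + 1) := hη (by omega)
  refine eq_zero_of_sum_bspline_eq_zero (c := fun r => c (m + r)) hη hj hb (fun x hx => ?_) r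
    (by omega)
  have hxb : x < η (n + 1) := hx.2.trans_le hb
  have h0 := hc x ⟨by
    rw [he _ (by omega) (by omega)]; exact (hη (by omega)).trans hx.1, by
    rw [he _ (by omega) (by omega)]; exact hxb⟩
  rw [spline_congr he (fun _ _ _ => rfl)] at h0
  unfold spline at h0
  rw [← h0]
  have hsub : Finset.Ico m (m + (p + 1)) ⊆ Finset.Icc 1 n := by
    intro k hk
    rw [Finset.mem_Ico] at hk
    rw [Finset.mem_Icc]
    omega
  rw [← Finset.sum_subset hsub, Finset.sum_Ico_eq_sum_range, Nat.add_sub_cancel_left]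
  intro k _ hk
  rw [Finset.mem_Ico, not_and_or, not_le, not_lt] at hk
  rcases hk with hk | hk
  · rw [bspline_eq_zero_of_before hη, mul_zero]
    exact (before_iff_of_lt hxb).2 ((hη (by omega)).trans hx.1)
  · rw [bspline_eq_zero_of_not_before hη, mul_zero]
    exact fun h3 => absurd ((before_iff_of_lt hxb).1 h3)
      (not_le.2 (hx.2.trans_le (hη (by omega))))

/-! ### Measurability and integrability -/

theorem measurable_bspline (b : ℝ) (ξ : ℕ → ℝ) (p i : ℕ) : Measurable (bspline b ξ p i) := by
  induction p generalizing i with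
  | zero =>
    have : bspline b ξ 0 i = ((Iio b ∩ Ico (ξ i) (ξ (i + 1))) ∪
        (Ici b ∩ Ioc (ξ i) (ξ (i + 1)))).indicator fun _ => 1 := by
      funext x
      classical
      rw [indicator_apply, bspline]
      exact if_congr Iff.rfl rfl rfl
    rw [this]
    exact measurable_const.indicator ((measurableSet_Iio.inter measurableSet_Ico).union
      (measurableSet_Ici.inter measurableSet_Ioc))
  | succ p ih =>
    rw [funext (bspline_succ b ξ p i)]
    have h1 := ih i
    have h2 := ih (i + 1)
    fun_prop

theorem measurable_spline (p n : ℕ) (ξ c : ℕ → ℝ) : Measurable (spline p n ξ c) :=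
  Finset.measurable_fun_sum _ fun i _ => (measurable_bspline _ _ _ i).const_mul (c i)

theorem memLp_spline {p n : ℕ} {ξ : ℕ → ℝ} (h : IsBasicKnotVector p n ξ) (c : ℕ → ℝ) (q : ℝ≥0∞) :
    MemLp (spline p n ξ c) q (volume.restrict (Ioo (ξ (p + 1)) (ξ (n + 1)))) := by
  obtain ⟨C, hC⟩ := abs_spline_le h c
  refine MemLp.of_bound (measurable_spline p n ξ c).aestronglyMeasurable C ?_
  rw [ae_restrict_iff' measurableSet_Ioo]
  exact ae_of_all _ fun x hx => hC x (Ioo_subset_Icc_self hx)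

theorem intervalIntegrable_spline {p n : ℕ} {ξ : ℕ → ℝ} (h : IsBasicKnotVector p n ξ)
    (c : ℕ → ℝ) {x : ℝ} (hx : x ∈ Icc (ξ (p + 1)) (ξ (n + 1))) :
    IntervalIntegrable (spline p n ξ c) volume (ξ (p + 1)) x := by
  rw [intervalIntegrable_iff_integrableOn_Ioo_of_le hx.1]
  exact IntegrableOn.mono_set (μ := volume) ((memLp_spline h c 1).integrable le_rfl)
    (Ioo_subset_Ioo_right hx.2)

/-! ### Primitives -/

theorem IsOpenKnotVector.derivKnots {p n : ℕ} {ξ : ℕ → ℝ} (h : IsOpenKnotVector (p + 1) n ξ)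
    (hr : ∀ i, p + 3 ≤ i → i ≤ n → knotMultiplicity (p + 1) n ξ (ξ i) ≤ p + 1) :
    IsOpenKnotVector p (n - 1) (derivKnots ξ) := by
  have hdim := h.dim
  obtain ⟨n, rfl⟩ : ∃ k, n = k + 1 := ⟨n - 1, by omega⟩
  rw [Nat.add_sub_cancel]
  refine ⟨⟨by omega, fun i j h1 h2 h3 => h.mono _ _ (by omega) (by omega) (by omega), h.left,
    h.right, fun i h1 h2 => ?_⟩, fun i h1 h2 => h.first _ (by omega) (by omega),
    fun i h1 h2 => h.last _ (by omega) (by omega)⟩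
  refine le_trans (le_of_eq ?_) (hr (i + 1) (by omega) (by omega))
  unfold knotMultiplicity
  refine Finset.card_bij (fun j _ => j + 1) ?_ (by intros; omega) ?_
  · intro j hj
    rw [Finset.mem_filter, Finset.mem_Icc] at hj ⊢
    exact ⟨by omega, hj.2⟩
  · intro j hj
    rw [Finset.mem_filter, Finset.mem_Icc] at hj
    refine ⟨j - 1, ?_, by omega⟩
    rw [Finset.mem_filter, Finset.mem_Icc]
    refine ⟨by omega, ?_⟩
    show ξ (j - 1 + 1) = _
    rw [show j - 1 + 1 = j by omega]
    exact hj.2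

theorem spline_eq_integral {p n : ℕ} {ξ : ℕ → ℝ} (h : IsOpenKnotVector (p + 1) n ξ)
    (hd : IsOpenKnotVector p (n - 1) (derivKnots ξ))
    (hr : ∀ i, p + 3 ≤ i → i + (p + 1) ≤ n → ξ i < ξ (i + (p + 1))) (c : ℕ → ℝ) {x : ℝ}
    (hx : x ∈ Icc (ξ (p + 2)) (ξ (n + 1))) :
    spline (p + 1) n ξ c x = c 1
      + ∫ t in (ξ (p + 2))..x, spline p (n - 1) (derivKnots ξ) (derivCoeff (p + 1) ξ c) t := by
  have hdim := h.dim
  have hb : derivKnots ξ (n - 1 + 1) = ξ (n + 1) := by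
    unfold derivKnots
    rw [show n - 1 + 1 + 1 = n + 1 by omega]
  have h1 := intervalIntegral.integral_eq_sub_of_hasDeriv_right_of_le hx.1
    ((continuousOn_spline h hr c).mono (Icc_subset_Icc_right hx.2))
    (fun t ht => (hasDerivWithinAt_spline h c (ht.2.trans_le hx.2)).mono Ioi_subset_Ici_self)
    (intervalIntegrable_spline hd.toIsBasicKnotVector _ (by rw [hb]; exact hx))
  rw [h1, spline_left_endpoint h]
  ring

/-! ### Multiplicities -/

/-- Equal knots are consecutive, so a bound `m` on the multiplicities means that interior knots `m`
places apart differ. Together with the converse below this replaces counting by an inequality that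
is easy to follow through index shifts. -/
theorem lt_of_knotMultiplicity_le {p n m : ℕ} {ξ : ℕ → ℝ}
    (hξ : ∀ i j, 1 ≤ i → i ≤ j → j ≤ n + p + 1 → ξ i ≤ ξ j)
    (h : ∀ i, p + 2 ≤ i → i ≤ n → knotMultiplicity p n ξ (ξ i) ≤ m) {i : ℕ} (h1 : p + 2 ≤ i)
    (h2 : i + m ≤ n) : ξ i < ξ (i + m) := by
  refine lt_of_le_of_ne (hξ _ _ (by omega) (by omega) (by omega)) fun he => ?_
  have hsub : Finset.Icc i (i + m) ⊆ (Finset.Icc (p + 2) n).filter fun j => ξ j = ξ i := by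
    intro j hj
    rw [Finset.mem_Icc] at hj
    rw [Finset.mem_filter, Finset.mem_Icc]
    refine ⟨by omega, le_antisymm ?_ (hξ _ _ (by omega) (by omega) (by omega))⟩
    rw [he]
    exact hξ _ _ (by omega) (by omega) (by omega)
  have h3 := (Finset.card_le_card hsub).trans (h i h1 (by omega))
  rw [Nat.card_Icc] at h3
  omega

theorem knotMultiplicity_le_of_lt {p n m : ℕ} {ξ : ℕ → ℝ}
    (hξ : ∀ i j, 1 ≤ i → i ≤ j → j ≤ n + p + 1 → ξ i ≤ ξ j)
    (h : ∀ i, p + 2 ≤ i → i + m ≤ n → ξ i < ξ (i + m)) (x : ℝ) :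
    knotMultiplicity p n ξ x ≤ m := by
  unfold knotMultiplicity
  rcases ((Finset.Icc (p + 2) n).filter fun i => ξ i = x).eq_empty_or_nonempty with h0 | h0
  · rw [h0]; simp
  · set F := (Finset.Icc (p + 2) n).filter fun i => ξ i = x with hF
    have h1 := F.min'_mem h0
    have h2 := F.max'_mem h0
    set k := F.min' h0
    set K := F.max' h0
    rw [hF, Finset.mem_filter, Finset.mem_Icc] at h1 h2
    have hsub : F ⊆ Finset.Icc k K := fun j hj =>
      Finset.mem_Icc.2 ⟨F.min'_le j hj, F.le_max' j hj⟩
    have hlt : K < k + m := by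
      by_contra hc
      have h3 := h k h1.1.1 (by omega)
      have h4 := hξ (k + m) K (by omega) (by omega) (by omega)
      rw [h1.2] at h3
      rw [h2.2] at h4
      exact absurd h3 (not_lt.2 h4)
    have := Finset.card_le_card hsub
    rw [Nat.card_Icc] at this
    omega

/-- The knots equal to an interior breakpoint are consecutive. -/
theorem exists_first_index {p n i₀ : ℕ} {ξ : ℕ → ℝ} (h : IsBasicKnotVector p n ξ)
    (hi : IsBreakIndex p n ξ i₀) :
    ∃ k, p + 2 ≤ k ∧ k ≤ i₀ ∧ (∀ j, k ≤ j → j ≤ i₀ → ξ j = ξ i₀) ∧ ξ (k - 1) < ξ i₀ ∧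
      knotMultiplicity p n ξ (ξ i₀) = i₀ + 1 - k := by
  obtain ⟨hi1, hi2, hi3⟩ := hi
  set F := (Finset.Icc (p + 2) n).filter fun i => ξ i = ξ i₀ with hF
  have hmem : i₀ ∈ F := by
    rw [hF, Finset.mem_filter, Finset.mem_Icc]
    exact ⟨⟨hi1, hi2⟩, rfl⟩
  have h1 := F.min'_mem ⟨i₀, hmem⟩
  have hk := F.min'_le i₀ hmem
  have hmin := fun j hj => F.min'_le j hj
  set k := F.min' ⟨i₀, hmem⟩
  rw [hF, Finset.mem_filter, Finset.mem_Icc] at h1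
  have hrun : ∀ j, k ≤ j → j ≤ i₀ → ξ j = ξ i₀ := fun j hj hj' =>
    le_antisymm (h.mono _ _ (by omega) hj' (by omega))
      (h1.2 ▸ h.mono _ _ (by omega) hj (by omega))
  refine ⟨k, h1.1.1, hk, hrun, ?_, ?_⟩
  · rcases eq_or_lt_of_le h1.1.1 with h2 | h2
    · rw [← h1.2, ← h2]
      exact h.left
    · refine lt_of_le_of_ne (h.mono _ _ (by omega) (by omega) (by omega)) fun h3 => ?_
      have := hmin (k - 1) (by
        rw [hF, Finset.mem_filter, Finset.mem_Icc]
        exact ⟨by omega, h3⟩)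
      omega
  · have : F = Finset.Icc k i₀ := by
      ext j
      rw [Finset.mem_Icc]
      refine ⟨fun hj => ⟨hmin j hj, ?_⟩, fun hj => ?_⟩
      · rw [hF, Finset.mem_filter, Finset.mem_Icc] at hj
        by_contra hc
        have := h.mono (i₀ + 1) j (by omega) (by omega) (by omega)
        rw [hj.2] at this
        exact absurd hi3 (not_lt.2 this)
      · rw [hF, Finset.mem_filter, Finset.mem_Icc]
        exact ⟨by omega, hrun j hj.1 hj.2⟩
    unfold knotMultiplicity
    rw [← hF, this, Nat.card_Icc]

theorem IsOpenKnotVector.removeKnot {p n i₀ : ℕ} {ξ : ℕ → ℝ} (h : IsOpenKnotVector p n ξ)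
    (h1 : p + 2 ≤ i₀) (h2 : i₀ ≤ n) : IsOpenKnotVector p (n - 1) (removeKnot i₀ ξ) := by
  obtain ⟨n, rfl⟩ : ∃ k, n = k + 1 := ⟨n - 1, by omega⟩
  rw [Nat.add_sub_cancel]
  have hlt : ∀ i, i < i₀ → KnotRemoval.removeKnot i₀ ξ i = ξ i := fun i hi => if_pos hi
  have hge : ∀ i, i₀ ≤ i → KnotRemoval.removeKnot i₀ ξ i = ξ (i + 1) :=
    fun i hi => if_neg (not_lt.2 hi)
  have hmono : ∀ i j, 1 ≤ i → i ≤ j → j ≤ n + p + 1 →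
      KnotRemoval.removeKnot i₀ ξ i ≤ KnotRemoval.removeKnot i₀ ξ j := by
    intro i j hi hij hj
    unfold KnotRemoval.removeKnot
    split_ifs <;> exact h.mono _ _ (by omega) (by omega) (by omega)
  refine ⟨⟨by omega, hmono, ?_, ?_, fun i _ _ => knotMultiplicity_le_of_lt hmono ?_ _⟩, ?_, ?_⟩
  · rw [hlt (p + 1) (by omega)]
    rcases lt_or_ge (p + 2) i₀ with h3 | h3
    · rw [hlt _ h3]; exact h.left
    · rw [hge _ h3]; exact h.left.trans_le (h.mono _ _ (by omega) (by omega) (by omega))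
  · rw [hge (n + 1) (by omega)]
    rcases lt_or_ge n i₀ with h3 | h3
    · rw [hlt _ h3]; exact (h.mono _ _ (by omega) (by omega) (by omega)).trans_lt h.right
    · rw [hge _ h3]; exact h.right
  · intro i hi hi'
    -- Knots `p + 1` places apart after the removal were at least that far apart before.
    have hm := fun {i} => lt_of_knotMultiplicity_le (i := i) h.mono h.mult
    rcases lt_or_ge i i₀ with h3 | h3
    · rw [hlt _ h3]
      rcases lt_or_ge (i + (p + 1)) i₀ with h4 | h4
      · rw [hlt _ h4]; exact hm hi (by omega)
      · rw [hge _ h4]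
        exact (hm hi (by omega)).trans_le (h.mono _ _ (by omega) (by omega) (by omega))
    · rw [hge _ h3, hge _ (by omega), show i + (p + 1) + 1 = i + 1 + (p + 1) by omega]
      exact hm (by omega) (by omega)
  · intro i hi hi'
    rw [hlt _ (by omega), hlt _ (by omega)]
    exact h.first i hi hi'
  · intro i hi hi'
    rw [hge _ (by omega), hge _ (by omega)]
    exact h.last _ (by omega) (by omega)

/-! ### The local least squares problem -/

/-- The local matrix is a window of the global insertion matrix. Nothing is cut off: the entries
that would reach outside are `1 - α_1` in the first row and `α_{p + 2 - ℓ}` in the last, and both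
vanish. -/
theorem Aloc_mulVec {p ℓ i₀ : ℕ} {ξ : ℕ → ℝ} (hp : p + 1 ≤ i₀) (hℓ : ℓ ≤ p)
    (h1 : ξ (i₀ - (p + 1)) < ξ i₀) (h2 : ξ (i₀ - ℓ) = ξ i₀) (c : ℕ → ℝ) (r : Fin (p + 2 - ℓ)) :
    (Aloc p ℓ ξ i₀).mulVec (fun s => c (i₀ - (p + 1) + s)) r
      = insertCoeff p ξ i₀ c (i₀ - (p + 1) + r) := by
  obtain ⟨r, hr⟩ := r
  obtain ⟨s₀, rfl⟩ : ∃ s₀, i₀ = s₀ + (p + 1) := ⟨i₀ - (p + 1), by omega⟩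
  rw [Nat.add_sub_cancel] at *
  set i₀ := s₀ + (p + 1) with hi₀
  set A := alpha p ξ i₀ (r + 1) with hA
  have hA' : A = (ξ i₀ - ξ (s₀ + r)) / (ξ (s₀ + r + p + 1) - ξ (s₀ + r)) := by
    rw [hA, alpha, show i₀ + (r + 1) - (p + 2) = s₀ + r by omega,
      show i₀ + (r + 1) - 1 = s₀ + r + p + 1 by omega]
  have hw : insertWeight p ξ i₀ (s₀ + r) = A := by
    unfold insertWeight
    rw [if_neg (by omega)]
    split_ifs with h
    · obtain rfl : r = p + 1 := by omega
      rw [hA', sub_self, zero_div]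
    · exact hA'.symm
  have h0 : r = 0 → A = 1 := by
    rintro rfl
    rw [hA', add_zero, show s₀ + p + 1 = i₀ by omega, div_self (sub_pos.2 h1).ne']
  have hlast : r = p + 1 - ℓ → A = 0 := by
    intro h
    rw [hA', show s₀ + r = i₀ - ℓ by omega, h2, sub_self, zero_div]
  unfold insertCoeff
  rw [hw]
  have hterm : ∀ s : Fin (p + 1 - ℓ), Aloc p ℓ ξ i₀ ⟨r, hr⟩ s * c (s₀ + s)
      = (fun s : ℕ => (if s = r then A * c (s₀ + s) else 0)
        + if s + 1 = r then (1 - A) * c (s₀ + s) else 0) s := by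
    intro s
    simp only [Aloc, Matrix.of_apply]
    split_ifs with h3 h4
    · omega
    · rw [add_zero]
    · rw [zero_add]
    · simp
  show ∑ s : Fin (p + 1 - ℓ), Aloc p ℓ ξ i₀ ⟨r, hr⟩ s * c (s₀ + s) = _
  rw [Finset.sum_congr rfl fun s _ => hterm s, Fin.sum_univ_eq_sum_range (fun s : ℕ =>
      (if s = r then A * c (s₀ + s) else 0) + if s + 1 = r then (1 - A) * c (s₀ + s) else 0),
    Finset.sum_add_distrib]
  congr 1
  · rw [Finset.sum_ite_eq' (Finset.range _) r fun s => A * c (s₀ + s)]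
    split_ifs with h3
    · rfl
    · rw [Finset.mem_range] at h3
      rw [hlast (by omega), zero_mul]
  · cases r with
    | zero => rw [h0 rfl]; simp
    | succ r =>
      simp only [Nat.add_right_cancel_iff]
      rw [Finset.sum_ite_eq' (Finset.range _) r fun s => (1 - A) * c (s₀ + s), if_pos,
        show s₀ + (r + 1) - 1 = s₀ + r by omega]
      rw [Finset.mem_range]
      omega

theorem weight_sq {p n i : ℕ} {ξ : ℕ → ℝ}
    (hξ : ∀ i j, 1 ≤ i → i ≤ j → j ≤ n + p + 1 → ξ i ≤ ξ j) (h1 : 1 ≤ i) (h2 : i ≤ n) :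
    weight p ξ i ^ 2 = (ξ (i + p + 1) - ξ i) / (p + 1) :=
  Real.sq_sqrt (div_nonneg (sub_nonneg.2 (hξ _ _ h1 (by omega) (by omega))) (by positivity))

/-- The residual of the local system is the part of the `Ξ`-norm of the error that comes from the
local control points. -/
theorem sum_residual_sq {p n ℓ i₀ : ℕ} {ξ : ℕ → ℝ} (h : IsBasicKnotVector p n ξ)
    (hp : p + 2 ≤ i₀) (hn : i₀ ≤ n) (hℓ : ℓ ≤ p) (h1 : ξ (i₀ - (p + 1)) < ξ i₀)
    (h2 : ξ (i₀ - ℓ) = ξ i₀) (c e : ℕ → ℝ) :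
    ∑ r, (((Eloc p ℓ ξ i₀ * Aloc p ℓ ξ i₀).mulVec (fun s => e (i₀ - (p + 1) + s))
        - (Eloc p ℓ ξ i₀).mulVec fun r => c (i₀ - (p + 1) + r)) r) ^ 2
      = ∑ i ∈ Finset.Icc (i₀ - (p + 1)) (i₀ - ℓ), (insertCoeff p ξ i₀ e i - c i) ^ 2
          * ((ξ (i + p + 1) - ξ i) / (p + 1)) := by
  have hI : Finset.Icc (i₀ - (p + 1)) (i₀ - ℓ)
      = Finset.Ico (i₀ - (p + 1)) (i₀ - (p + 1) + (p + 2 - ℓ)) := by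
    ext j
    rw [Finset.mem_Icc, Finset.mem_Ico]
    omega
  rw [hI, Finset.sum_Ico_eq_sum_range, Nat.add_sub_cancel_left,
    ← Fin.sum_univ_eq_sum_range fun r => (insertCoeff p ξ i₀ e (i₀ - (p + 1) + r)
      - c (i₀ - (p + 1) + r)) ^ 2
      * ((ξ (i₀ - (p + 1) + r + p + 1) - ξ (i₀ - (p + 1) + r)) / (p + 1))]
  refine Finset.sum_congr rfl fun r _ => ?_
  rw [← Matrix.mulVec_mulVec, ← Matrix.mulVec_sub, Eloc, Matrix.mulVec_diagonal, Pi.sub_apply,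
    Aloc_mulVec (by omega) hℓ h1 h2, mul_pow,
    weight_sq h.mono (by omega) (by have := r.2; omega), mul_comm]

/-- Outside the window the insertion weights are 1 or 0, so the kept control points are reproduced
exactly and the error lives in the window. -/
theorem insertCoeff_update {p ℓ i₀ i : ℕ} {ξ c c' : ℕ → ℝ} (h1 : 1 ≤ i)
    (hℓ : ℓ ≤ p) (hrun : ∀ j, i₀ - ℓ ≤ j → j ≤ i₀ → ξ j = ξ i₀) (hu : IsUpdate p ℓ ξ i₀ c c')
    (hi : i < i₀ - (p + 1) ∨ i₀ - ℓ < i) : insertCoeff p ξ i₀ c' i = c i := by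
  unfold insertCoeff
  rcases hi with hi | hi
  · have w : insertWeight p ξ i₀ i = 1 := if_pos (by omega)
    rw [w, hu.1 i (by omega)]
    ring
  · have w : insertWeight p ξ i₀ i = 0 := by
      unfold insertWeight
      rw [if_neg (by omega)]
      split_ifs with h4
      · rfl
      · rw [hrun i hi.le (by omega), sub_self, zero_div]
    rw [w, hu.2.2 (i - 1) (by omega), show i - 1 + 1 = i by omega]
    ring

/-- The update attains the distance to the coarse spline space. -/
theorem xiNorm_update_le_indicator {p n i₀ : ℕ} {ξ c c' : ℕ → ℝ} (h : IsOpenKnotVector p n ξ)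
    (hi : IsBreakIndex p n ξ i₀)
    (hu : IsUpdate p (knotMultiplicity p n ξ (ξ i₀) - 1) ξ i₀ c c') :
    xiNorm p n ξ (fun i => insertCoeff p ξ i₀ c' i - c i) ≤ indicator p n ξ c i₀ := by
  obtain ⟨k, hk1, hk2, hrun, hk3, hmul⟩ := exists_first_index h.toIsBasicKnotVector hi
  have hm := h.mult i₀ hi.1 hi.2.1
  obtain ⟨hi1, hi2, hi3⟩ := hi
  obtain ⟨ℓ, hℓ⟩ : ∃ ℓ, knotMultiplicity p n ξ (ξ i₀) - 1 = ℓ := ⟨_, rfl⟩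
  rw [hℓ] at hu
  have hkℓ : k = i₀ - ℓ := by omega
  subst hkℓ
  have hlt : ξ (i₀ - (p + 1)) < ξ i₀ :=
    (h.mono _ _ (by omega) (by omega) (by omega)).trans_lt hk3
  have hend : ξ (i₀ - ℓ) = ξ i₀ := hrun _ le_rfl hk2
  have hsub : Finset.Icc (i₀ - (p + 1)) (i₀ - ℓ) ⊆ Finset.Icc 1 n :=
    Finset.Icc_subset_Icc (by omega) (by omega)
  have hmin : ∀ e : ℕ → ℝ, xiNorm p n ξ (fun i => insertCoeff p ξ i₀ c' i - c i)
      ≤ xiNorm p n ξ (fun i => insertCoeff p ξ i₀ e i - c i) := by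
    intro e
    refine Real.sqrt_le_sqrt ?_
    have h3 := hu.2.1 fun s => e (i₀ - (p + 1) + s)
    rw [sum_residual_sq h.toIsBasicKnotVector hi1 hi2 (by omega) hlt hend,
      sum_residual_sq h.toIsBasicKnotVector hi1 hi2 (by omega) hlt hend] at h3
    -- The updated spline has no error outside the window, while a competitor can only add
    -- nonnegative terms there.
    rw [← Finset.sum_subset hsub]
    · refine h3.trans (Finset.sum_le_sum_of_subset_of_nonneg hsub fun i hi _ => ?_)
      rw [Finset.mem_Icc] at hi
      exact mul_nonneg (sq_nonneg _) (div_nonneg (sub_nonneg.2 (h.mono _ _ (by omega) (by omega)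
        (by omega))) (by positivity))
    · intro i hi hi'
      rw [Finset.mem_Icc] at hi hi'
      simp only [insertCoeff_update hi.1 (by omega) hrun hu (by omega), sub_self]
      ring
  have hspl : ∀ (e : ℕ → ℝ) x, spline p (n - 1) (removeKnot i₀ ξ) e x - spline p n ξ c x
      = spline p n ξ (fun i => insertCoeff p ξ i₀ e i - c i) x := fun e x => by
    rw [spline_removeKnot h.mono hi1 hi2, spline_sub]
  have hI : Icc (removeKnot i₀ ξ (p + 1)) (removeKnot i₀ ξ (n - 1 + 1))
      = Icc (ξ (p + 1)) (ξ (n + 1)) := by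
    unfold removeKnot
    rw [if_pos (by omega), if_neg (by omega), show n - 1 + 1 = n by omega]
  -- The updated spline itself shows that the set of distances is nonempty, which a lower bound for
  -- a real `sInf` requires.
  refine le_csInf ⟨_, spline p (n - 1) (removeKnot i₀ ξ) c', ⟨c', fun _ _ => rfl⟩, _,
    fun x _ => hspl c' x, rfl⟩ ?_
  rintro r ⟨g, ⟨e, hg⟩, d, hd, rfl⟩
  rw [hI] at hg
  refine (hmin e).trans (le_of_eq (congrArg Real.sqrt (Finset.sum_congr rfl fun i hi => ?_)))
  rw [Finset.mem_Icc] at hi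
  -- An index with degenerate support has weight zero; at any other, linear independence identifies
  -- `d i` with the coefficient from knot insertion.
  rcases (h.mono i (i + p + 1) hi.1 (by omega) (by omega)).eq_or_lt with h3 | h3
  · rw [h3, sub_self, zero_div, mul_zero, mul_zero]
  · have := coeff_eq_zero_of_spline_eq_zero h
      (c := fun i => (insertCoeff p ξ i₀ e i - c i) - d i) (fun x hx => by
        have hx' := Ico_subset_Icc_self hx
        rw [← spline_sub, ← hspl, ← hd hx', ← hg hx', sub_self]) hi.1 hi.2 h3
    simp only [sub_eq_zero.1 this]

/-- The range of `M` is a finite-dimensional, hence closed, subspace of Euclidean space and contains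
a point nearest to `y`; no rank condition is needed. -/
theorem exists_isLeastSquares {k m : ℕ} (M : Matrix (Fin k) (Fin m) ℝ) (y : Fin k → ℝ) :
    ∃ x, IsLeastSquares M y x := by
  let L : (Fin m → ℝ) →ₗ[ℝ] EuclideanSpace ℝ (Fin k) :=
    (WithLp.linearEquiv 2 ℝ (Fin k → ℝ)).symm.toLinearMap ∘ₗ M.mulVecLin
  have hL : ∀ z r, L z r = M.mulVec z r := fun z r => rfl
  obtain ⟨w, ⟨x, rfl⟩, hw⟩ := (Submodule.closed_of_finiteDimensional
    (LinearMap.range L)).exists_infDist_eq_dist ⟨0, Submodule.zero_mem _⟩ (WithLp.toLp 2 y)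
  refine ⟨x, fun z => ?_⟩
  have h1 : dist (WithLp.toLp 2 y) (L x) ≤ dist (WithLp.toLp 2 y) (L z) :=
    hw ▸ Metric.infDist_le_dist_of_mem ⟨z, rfl⟩
  rw [dist_comm, dist_comm _ (L z), EuclideanSpace.dist_eq, EuclideanSpace.dist_eq,
    Real.sqrt_le_sqrt_iff (Finset.sum_nonneg fun _ _ => sq_nonneg _)] at h1
  simpa only [hL, Real.dist_eq, sq_abs, Pi.sub_apply] using h1

theorem exists_isUpdate {p ℓ i₀ : ℕ} (hp : p + 1 ≤ i₀) (hℓ : ℓ ≤ p) (ξ c : ℕ → ℝ) :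
    ∃ c', IsUpdate p ℓ ξ i₀ c c' := by
  obtain ⟨x, hx⟩ := exists_isLeastSquares (Eloc p ℓ ξ i₀ * Aloc p ℓ ξ i₀)
    ((Eloc p ℓ ξ i₀).mulVec fun r => c (i₀ - (p + 1) + r))
  refine ⟨fun i => if i + (p + 2) ≤ i₀ then c i else if h : i - (i₀ - (p + 1)) < p + 1 - ℓ
    then x ⟨i - (i₀ - (p + 1)), h⟩ else c (i + 1), fun i hi => if_pos hi, ?_, fun i hi => ?_⟩
  · convert hx using 2 with s
    have := s.2
    show (if _ then _ else _) = _
    rw [if_neg (by omega), dif_pos (by omega)]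
    congr 1
    exact Fin.ext (by simp)
  · show (if _ then _ else _) = _
    rw [if_neg (by omega), dif_neg (by omega)]

/-! ### Primitives of splines -/

/-- Repeating the end knots amounts to clamping the shifted index. -/
theorem primKnots_eq {q N i : ℕ} {θ : ℕ → ℝ} (h2 : i ≤ N + q + 3) :
    primKnots (N + (q + 1)) θ i = θ (max 1 (min (i - 1) (N + q + 1))) := by
  unfold primKnots
  split_ifs
  · rw [show max 1 (min (i - 1) (N + q + 1)) = 1 by omega]
  · rw [show max 1 (min (i - 1) (N + q + 1)) = i - 1 by omega]
  · rw [show max 1 (min (i - 1) (N + q + 1)) = N + (q + 1) by omega]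

theorem primKnots_succ {q N i : ℕ} {θ : ℕ → ℝ} (h1 : 1 ≤ i) (h2 : i ≤ N + q + 1) :
    primKnots (N + (q + 1)) θ (i + 1) = θ i := by
  rw [primKnots_eq (by omega), show max 1 (min (i + 1 - 1) (N + q + 1)) = i by omega]

theorem primKnots_mono {q N : ℕ} {θ : ℕ → ℝ} (h : IsOpenKnotVector q N θ) (i j : ℕ) (_h1 : 1 ≤ i)
    (hij : i ≤ j) (hj : j ≤ N + 1 + (q + 1) + 1) :
    primKnots (N + (q + 1)) θ i ≤ primKnots (N + (q + 1)) θ j := by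
  rw [primKnots_eq (by omega), primKnots_eq (by omega)]
  exact h.mono _ _ (by omega) (by omega) (by omega)

/-- The multiplicities stay at most `q + 1` while the degree rises to `q + 1`, which is what
continuity of the primitive requires. -/
theorem primKnots_lt {q N i : ℕ} {θ : ℕ → ℝ} (h : IsOpenKnotVector q N θ) (h1 : q + 3 ≤ i)
    (h2 : i + (q + 1) ≤ N + 1) :
    primKnots (N + (q + 1)) θ i < primKnots (N + (q + 1)) θ (i + (q + 1)) := by
  obtain ⟨i, rfl⟩ : ∃ k, i = k + 1 := ⟨i - 1, by omega⟩
  rw [show i + 1 + (q + 1) = i + (q + 1) + 1 by omega, primKnots_succ (by omega) (by omega),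
    primKnots_succ (by omega) (by omega)]
  exact lt_of_knotMultiplicity_le h.mono h.mult (by omega) (by omega)

theorem IsOpenKnotVector.primKnots {q N : ℕ} {θ : ℕ → ℝ} (h : IsOpenKnotVector q N θ) :
    IsOpenKnotVector (q + 1) (N + 1) (primKnots (N + (q + 1)) θ) := by
  have hdim := h.dim
  refine ⟨⟨by omega, primKnots_mono h, ?_, ?_, fun i _ _ =>
    (knotMultiplicity_le_of_lt (primKnots_mono h) (fun i h1 h2 => primKnots_lt h h1 h2) _).trans
      (Nat.le_succ _)⟩, fun i h1 h2 => ?_, fun i h1 h2 => ?_⟩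
  · rw [primKnots_succ (by omega) (by omega), primKnots_succ (by omega) (by omega)]
    exact h.left
  · rw [primKnots_succ (by omega) (by omega), primKnots_succ (by omega) (by omega)]
    exact h.right
  · rw [primKnots_eq (by omega), primKnots_succ (by omega) (by omega)]
    exact h.first _ (by omega) (by omega)
  · rw [primKnots_eq (by omega), primKnots_succ (by omega) (by omega)]
    exact h.last _ (by omega) (by omega)

theorem primCoeff_succ (p : ℕ) (ξ : ℕ → ℝ) (c₁ : ℝ) (c : ℕ → ℝ) (j : ℕ) :
    primCoeff p ξ c₁ c (j + 1) = c₁ + ∑ k ∈ Finset.range j,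
      c (k + 1) * (greville p ξ (k + 2) - greville p ξ (k + 1)) := by
  induction j with
  | zero => simp [primCoeff]
  | succ j ih => rw [primCoeff, ih, Finset.sum_range_succ]; ring

/-- Summing and dividing by the same Greville differences are inverse operations wherever the
difference is nonzero; elsewhere the B-spline vanishes. -/
theorem spline_derivCoeff_primCoeff {q N : ℕ} {θ : ℕ → ℝ} (h : IsOpenKnotVector q N θ) (c₁ : ℝ)
    (c : ℕ → ℝ) (x : ℝ) :
    spline q N (derivKnots (primKnots (N + (q + 1)) θ)) (derivCoeff (q + 1)
      (primKnots (N + (q + 1)) θ) (primCoeff (q + 1) (primKnots (N + (q + 1)) θ) c₁ c)) x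
      = spline q N θ c x := by
  rw [spline_congr (ξ := derivKnots (primKnots (N + (q + 1)) θ)) (η := θ) (fun i h1 h2 => primKnots_succ h1 (by omega)) (fun _ _ _ => rfl)]
  obtain ⟨η, hη, he⟩ := exists_monotone_extension (by omega) h.mono
  rw [spline_congr he (fun _ _ _ => rfl), spline_congr he (fun _ _ _ => rfl)]
  unfold spline
  refine Finset.sum_congr rfl fun i hi => ?_
  rw [Finset.mem_Icc] at hi
  by_cases h0 : η (i + q + 1) = η i
  · rw [bspline_eq_zero_of_eq hη h0, mul_zero, mul_zero]
  · congr 1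
    obtain ⟨i, rfl⟩ : ∃ k, i = k + 1 := ⟨i - 1, by omega⟩
    have hne : ((q + 1 : ℕ) : ℝ) ≠ 0 := by positivity
    rw [derivCoeff_succ, primCoeff, greville_succ_sub,
      show i + 1 + q + 2 = i + 1 + q + 1 + 1 by omega, primKnots_succ (by omega) (by omega),
      primKnots_succ (by omega) (by omega), he _ (by omega) (by omega), he _ (by omega) (by omega),
      add_sub_cancel_right]
    have := sub_ne_zero.2 h0
    field_simp

theorem spline_primCoeff_eq_integral {q N : ℕ} {θ : ℕ → ℝ} (h : IsOpenKnotVector q N θ) (c₁ : ℝ)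
    (c : ℕ → ℝ) {x : ℝ} (hx : x ∈ Icc (θ (q + 1)) (θ (N + 1))) :
    spline (q + 1) (N + 1) (primKnots (N + (q + 1)) θ)
        (primCoeff (q + 1) (primKnots (N + (q + 1)) θ) c₁ c) x
      = c₁ + ∫ t in (θ (q + 1))..x, spline q N θ c t := by
  have hdim := h.dim
  have h1 : KnotRemoval.primKnots (N + (q + 1)) θ (q + 2) = θ (q + 1) :=
    primKnots_succ (by omega) (by omega)
  have h2 : KnotRemoval.primKnots (N + (q + 1)) θ (N + 1 + 1) = θ (N + 1) :=
    primKnots_succ (by omega) (by omega)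
  have h3 := spline_eq_integral h.primKnots (h.primKnots.derivKnots fun i _ _ =>
    knotMultiplicity_le_of_lt (primKnots_mono h) (fun i h1 h2 => primKnots_lt h h1 h2) _)
    (fun i h1 h2 => primKnots_lt h h1 h2)
    (primCoeff (q + 1) (KnotRemoval.primKnots (N + (q + 1)) θ) c₁ c) (x := x)
    (by rw [h1, h2]; exact hx)
  rw [h3, h1]
  simp only [Nat.add_sub_cancel, spline_derivCoeff_primCoeff h]
  rfl

/-- The integral is the value at `b` of the primitive spline, hence at most its largest control
point. Those control points are partial sums of the right-hand side, whose terms are nonnegative. -/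
theorem integral_spline_le {q N : ℕ} {θ : ℕ → ℝ} (h : IsOpenKnotVector q N θ) {c : ℕ → ℝ}
    (hc : ∀ i, 0 ≤ c i) :
    ∫ t in (θ (q + 1))..(θ (N + 1)), spline q N θ c t
      ≤ ∑ i ∈ Finset.Icc 1 N, c i * ((θ (i + q + 1) - θ i) / (q + 1)) := by
  have hdim := h.dim
  have h1 := spline_primCoeff_eq_integral h 0 c ⟨h.lt.le, le_rfl⟩
  rw [zero_add] at h1
  rw [← h1]
  refine spline_le_of_le h.primKnots.toIsBasicKnotVector ?_ fun i hi hi' => ?_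
  · rw [primKnots_succ (by omega) (by omega), primKnots_succ (by omega) (by omega)]
    exact ⟨h.lt.le, le_rfl⟩
  · obtain ⟨i, rfl⟩ : ∃ k, i = k + 1 := ⟨i - 1, by omega⟩
    rw [primCoeff_succ, zero_add, show Finset.Icc 1 N = Finset.Ico 1 (N + 1) from rfl,
      Finset.sum_Ico_eq_sum_range, Nat.add_sub_cancel]
    refine le_trans (le_of_eq (Finset.sum_congr rfl fun k hk => ?_))
      (Finset.sum_le_sum_of_subset_of_nonneg (Finset.range_subset_range.2 (show i ≤ N by omega))
        fun k hk _ => ?_)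
    · rw [Finset.mem_range] at hk
      rw [greville_succ_sub, show k + 1 + q + 2 = k + 1 + q + 1 + 1 by omega,
        primKnots_succ (by omega) (by omega), primKnots_succ (by omega) (by omega),
        add_comm 1 k]
      push_cast
      rfl
    · rw [Finset.mem_range] at hk
      exact mul_nonneg (hc _) (div_nonneg (sub_nonneg.2 (h.mono _ _ (by omega) (by omega)
        (by omega))) (by positivity))

/-- The `L²` norm of a spline is at most its `Ξ`-norm. -/
theorem eLpNorm_spline_le {q N : ℕ} {θ : ℕ → ℝ} (h : IsOpenKnotVector q N θ) (d : ℕ → ℝ) :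
    eLpNorm (spline q N θ d) 2 (volume.restrict (Ioo (θ (q + 1)) (θ (N + 1))))
      ≤ ENNReal.ofReal (xiNorm q N θ d) := by
  have hm := memLp_spline h.toIsBasicKnotVector d 2
  rw [hm.eLpNorm_eq_integral_rpow_norm two_ne_zero ENNReal.ofNat_ne_top]
  refine ENNReal.ofReal_le_ofReal ?_
  unfold xiNorm
  rw [Real.sqrt_eq_rpow, ENNReal.toReal_ofNat, ← one_div]
  refine Real.rpow_le_rpow (integral_nonneg fun x => by positivity) ?_ (by norm_num)
  -- The squared `Ξ`-norm bounds the integral of the spline with control points `d i ^ 2`, which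
  -- dominates the squared spline pointwise.
  refine le_trans ?_ (integral_spline_le h fun i => sq_nonneg (d i))
  rw [intervalIntegral.integral_of_le h.lt.le, integral_Ioc_eq_integral_Ioo]
  refine setIntegral_mono_on ?_ ((memLp_spline h.toIsBasicKnotVector _ 1).integrable le_rfl)
    measurableSet_Ioo fun x hx => ?_
  · rw [IntegrableOn]
    simpa using hm.integrable_sq
  · rw [Real.rpow_two, Real.norm_eq_abs, sq_abs]
    exact spline_sq_le h.toIsBasicKnotVector d (Ioo_subset_Icc_self hx)

/-! ### The `H¹` norm -/

/-- Integration by parts needs only continuity and an integrable right derivative; test functions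
vanish at `a` and `b`. -/
theorem isWeakDeriv_of_hasDerivWithinAt {a b : ℝ} (hab : a < b) {u v : ℝ → ℝ}
    (huc : ContinuousOn u (Icc a b)) (hud : ∀ x ∈ Ioo a b, HasDerivWithinAt u (v x) (Ioi x) x)
    (hv : IntegrableOn v (Ioo a b)) : IsWeakDeriv a b u v := by
  refine ⟨(huc.integrableOn_Icc.mono_set Ioo_subset_Icc_self).locallyIntegrableOn,
    hv.locallyIntegrableOn, fun φ hφ _ hsupp => ?_⟩
  have hz : ∀ x, x ∉ Ioo a b → φ x = 0 := fun x hx =>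
    image_eq_zero_of_notMem_tsupport fun h => hx (hsupp h)
  have hφd := hφ.differentiable (by simp)
  have h1 := intervalIntegral.integral_mul_deriv_eq_deriv_mul_of_hasDeriv_right
    (a := a) (b := b) (u := u) (v := φ) (u' := v) (v' := deriv φ)
    (by rwa [uIcc_of_le hab.le]) hφ.continuous.continuousOn
    (by rwa [min_eq_left hab.le, max_eq_right hab.le])
    (fun x _ => (hφd x).hasDerivAt.hasDerivWithinAt)
    ((intervalIntegrable_iff_integrableOn_Ioo_of_le hab.le).2 hv)
    ((hφ.continuous_deriv (by simp)).intervalIntegrable _ _)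
  rw [hz a (by simp), hz b (by simp), mul_zero, mul_zero, sub_zero, zero_sub,
    intervalIntegral.integral_of_le hab.le, intervalIntegral.integral_of_le hab.le,
    integral_Ioc_eq_integral_Ioo, integral_Ioc_eq_integral_Ioo] at h1
  exact h1

theorem h1Norm_lt {a b tol δ : ℝ} (hab : a < b) {u v : ℝ → ℝ}
    (huc : ContinuousOn u (Icc a b)) (hud : ∀ x ∈ Ioo a b, HasDerivWithinAt u (v x) (Ioi x) x)
    (hua : u a = 0) (hv : MemLp v 2 (volume.restrict (Ioo a b))) (hδ : 0 ≤ δ)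
    (hvδ : eLpNorm v 2 (volume.restrict (Ioo a b)) ≤ ENNReal.ofReal δ)
    (hlt : δ * √((b - a) ^ 2 + 1) < tol) : h1Norm a b u < ENNReal.ofReal tol := by
  set μ := volume.restrict (Ioo a b) with hμ
  have hba := sub_pos.2 hab
  have huniv : μ univ = ENNReal.ofReal (b - a) := by simp [hμ]
  have hv1 : Integrable v μ := hv.integrable (by norm_num)
  have hvi : IntervalIntegrable v volume a b :=
    (intervalIntegrable_iff_integrableOn_Ioo_of_le hab.le).2 hv1
  -- Cauchy–Schwarz on an interval of length `b - a`.
  have hL1 : ∫ x in a..b, |v x| ≤ δ * √(b - a) := by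
    rw [intervalIntegral.integral_of_le hab.le, integral_Ioc_eq_integral_Ioo]
    have h1 := eLpNorm_le_eLpNorm_mul_rpow_measure_univ (p := 1) (q := 2) (by norm_num) hv1.1
    rw [huniv, ENNReal.toReal_one, ENNReal.toReal_ofNat,
      ENNReal.ofReal_rpow_of_pos hba, eLpNorm_one_eq_lintegral_enorm,
      ← ofReal_integral_norm_eq_lintegral_enorm hv1] at h1
    have h2 := h1.trans (mul_le_mul_left hvδ _)
    rw [← ENNReal.ofReal_mul hδ, ENNReal.ofReal_le_ofReal_iff
      (mul_nonneg hδ (Real.rpow_nonneg hba.le _))] at h2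
    rw [Real.sqrt_eq_rpow, show (1 / 2 : ℝ) = 1 / 1 - 1 / 2 by norm_num]
    exact h2
  have hsup : ∀ x ∈ Ioo a b, ‖u x‖ ≤ δ * √(b - a) := by
    intro x hx
    have hsub : uIcc a x ⊆ uIcc a b := by
      rw [uIcc_of_le hx.1.le, uIcc_of_le hab.le]
      exact Icc_subset_Icc_right hx.2.le
    have h1 := intervalIntegral.integral_eq_sub_of_hasDeriv_right_of_le hx.1.le
      (huc.mono (Icc_subset_Icc_right hx.2.le)) (fun t ht => hud t ⟨ht.1, ht.2.trans hx.2⟩)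
      (hvi.mono_set hsub)
    rw [hua, sub_zero] at h1
    rw [← h1]
    refine (intervalIntegral.norm_integral_le_integral_norm hx.1.le).trans (le_trans ?_ hL1)
    exact intervalIntegral.integral_mono_interval le_rfl hx.1.le hx.2.le
      (ae_of_all _ fun _ => abs_nonneg _) hvi.abs
  have huδ : eLpNorm u 2 μ ≤ ENNReal.ofReal (δ * (b - a)) := by
    have h1 := eLpNorm_le_of_ae_bound (p := 2) (μ := μ)
      ((ae_restrict_iff' measurableSet_Ioo).2 (ae_of_all _ hsup))
    rw [huniv, ENNReal.ofReal_rpow_of_nonneg hba.le (by norm_num),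
      ← ENNReal.ofReal_mul (Real.rpow_nonneg hba.le _), ENNReal.toReal_ofNat, ← one_div,
      ← Real.sqrt_eq_rpow] at h1
    refine h1.trans (ENNReal.ofReal_le_ofReal (le_of_eq ?_))
    rw [mul_left_comm, Real.mul_self_sqrt hba.le]
  refine lt_of_le_of_lt (iInf₂_le v (isWeakDeriv_of_hasDerivWithinAt hab huc hud hv1)) ?_
  have h1 : (eLpNorm u 2 μ ^ 2 + eLpNorm v 2 μ ^ 2) ^ (1 / 2 : ℝ)
      ≤ ENNReal.ofReal (δ * √((b - a) ^ 2 + 1)) := by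
    refine (ENNReal.rpow_le_rpow (add_le_add (pow_le_pow_left₀ (by positivity) huδ 2)
      (pow_le_pow_left₀ (by positivity) hvδ 2)) (by norm_num)).trans (le_of_eq ?_)
    rw [← ENNReal.ofReal_pow (by positivity), ← ENNReal.ofReal_pow hδ,
      ← ENNReal.ofReal_add (by positivity) (by positivity),
      ENNReal.ofReal_rpow_of_nonneg (by positivity) (by norm_num), ← Real.sqrt_eq_rpow,
      show (δ * (b - a)) ^ 2 + δ ^ 2 = δ ^ 2 * ((b - a) ^ 2 + 1) by ring,
      Real.sqrt_mul (sq_nonneg δ), Real.sqrt_sq hδ]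
  refine h1.trans_lt ((ENNReal.ofReal_lt_ofReal_iff ?_).2 hlt)
  exact lt_of_le_of_lt (by positivity) hlt

/-! ### Knot removal and spline spaces -/

/-- Removal commutes with doubling the end knots up to a shift of the index; this carries the
inclusion of knot vectors and spline spaces through the loop. -/
theorem primKnots_removeKnot {q N i₀ i : ℕ} {θ : ℕ → ℝ} (h1 : q + 2 ≤ i₀) (h2 : i₀ ≤ N)
    (hi : i ≤ N + q + 2) :
    primKnots (N - 1 + (q + 1)) (removeKnot i₀ θ) i
      = removeKnot (i₀ + 1) (primKnots (N + (q + 1)) θ) i := by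
  rw [primKnots_eq (by omega)]
  unfold removeKnot
  split_ifs
  · rw [primKnots_eq (by omega)]
    congr 1
    omega
  · omega
  · rw [primKnots_eq (by omega)]
    congr 1
    omega
  · rw [primKnots_eq (by omega)]
    congr 1
    omega

theorem primKnots_derivKnots {q n i : ℕ} {ξ : ℕ → ℝ} (h : IsOpenKnotVector (q + 1) n ξ)
    (h1 : 1 ≤ i) (h2 : i ≤ n + (q + 1) + 1) :
    primKnots (n - 1 + (q + 1)) (derivKnots ξ) i = ξ i := by
  have hdim := h.dim
  rw [primKnots_eq (by omega), derivKnots]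
  rcases lt_or_ge i 2 with h3 | h3
  · rw [h.first i h1 (by omega)]
    exact h.first _ (by omega) (by omega)
  · rcases lt_or_ge (n + q + 1) i with h4 | h4
    · rw [h.last i (by omega) h2]
      exact h.last _ (by omega) (by omega)
    · congr 1
      omega

theorem knotList_congr {p n : ℕ} {ξ η : ℕ → ℝ} (h : ∀ i, 1 ≤ i → i ≤ n + p + 1 → ξ i = η i) :
    knotList p n ξ = knotList p n η :=
  List.map_congr_left fun i hi => h (i + 1) (by omega) (by
    have := List.mem_range.1 hi
    omega)

theorem knotList_removeKnot_sublist {p n i₀ : ℕ} {ξ : ℕ → ℝ} (h1 : 1 ≤ i₀) (h2 : i₀ ≤ n) :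
    (knotList p (n - 1) (removeKnot i₀ ξ)).Sublist (knotList p n ξ) := by
  -- Knots are numbered from 1, list entries from 0.
  have : knotList p (n - 1) (removeKnot i₀ ξ) = (knotList p n ξ).eraseIdx (i₀ - 1) := by
    have hl : i₀ - 1 < (knotList p n ξ).length := by
      simp only [knotList, List.length_map, List.length_range]
      omega
    refine List.ext_getElem ?_ fun i hi hi' => ?_
    · rw [List.length_eraseIdx_of_lt hl]
      simp only [knotList, List.length_map, List.length_range]
      omega
    · rw [List.getElem_eraseIdx]
      simp only [knotList, List.getElem_map, List.getElem_range, removeKnot]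
      split_ifs <;> first | rfl | omega
  rw [this]
  exact List.eraseIdx_sublist _ _

theorem splineSpace_congr {p n : ℕ} {ξ η : ℕ → ℝ} (hn : p ≤ n)
    (h : ∀ i, 1 ≤ i → i ≤ n + p + 1 → ξ i = η i) : splineSpace p n ξ = splineSpace p n η := by
  ext f
  unfold splineSpace
  rw [mem_ofPred_eq, mem_ofPred_eq, h (p + 1) (by omega) (by omega), h (n + 1) (by omega) (by omega)]
  refine exists_congr fun c => ?_
  rw [funext (spline_congr h fun _ _ _ => rfl)]

theorem splineSpace_removeKnot_subset {p n i₀ : ℕ} {ξ : ℕ → ℝ}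
    (hξ : ∀ i j, 1 ≤ i → i ≤ j → j ≤ n + p + 1 → ξ i ≤ ξ j) (h1 : p + 2 ≤ i₀) (h2 : i₀ ≤ n) :
    splineSpace p (n - 1) (removeKnot i₀ ξ) ⊆ splineSpace p n ξ := by
  rintro f ⟨c, hf⟩
  have hl : removeKnot i₀ ξ (p + 1) = ξ (p + 1) := if_pos (by omega)
  have hr : removeKnot i₀ ξ (n - 1 + 1) = ξ (n + 1) := by
    rw [show n - 1 + 1 = n by omega]
    exact if_neg (by omega)
  rw [hl, hr] at hf
  exact ⟨insertCoeff p ξ i₀ c, fun x hx => (hf hx).trans (spline_removeKnot hξ h1 h2 c x)⟩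

/-! ### The algorithm -/

/-- The properties that a pass through the while loop preserves. -/
structure IsApproximation (q n : ℕ) (ξ : ℕ → ℝ) (f : ℝ → ℝ) (T : ℝ) (S : State) : Prop where
  isOpen : IsOpenKnotVector q S.n S.ξ
  left : S.ξ (q + 1) = ξ (q + 2)
  right : S.ξ (S.n + 1) = ξ (n + 1)
  sublist : (knotList (q + 1) (S.n + 1) (primKnots (S.n + (q + 1)) S.ξ)).Sublist
    (knotList (q + 1) n ξ)
  subset : splineSpace (q + 1) (S.n + 1) (primKnots (S.n + (q + 1)) S.ξ) ⊆ splineSpace (q + 1) n ξ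
  tol_pos : 0 < S.tol
  tol_le : S.tol ≤ T
  error : eLpNorm (fun x => f x - spline q S.n S.ξ S.c x) 2
    (volume.restrict (Ioo (ξ (q + 2)) (ξ (n + 1)))) ≤ ENNReal.ofReal (T - S.tol)

theorem isApproximation_start {q n : ℕ} {ξ : ℕ → ℝ} (h : IsOpenKnotVector (q + 1) n ξ)
    (hmult : ∀ i, q + 3 ≤ i → i ≤ n → knotMultiplicity (q + 1) n ξ (ξ i) ≤ q + 1) (c : ℕ → ℝ)
    {T : ℝ} (hT : 0 < T) :
    IsApproximation q n ξ (spline q (n - 1) (derivKnots ξ) c) T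
      (l2Start (n - 1) (derivKnots ξ) c T) := by
  have hdim := h.dim
  have he : ∀ i, 1 ≤ i → i ≤ n - 1 + 1 + (q + 1) + 1 →
      primKnots (n - 1 + (q + 1)) (derivKnots ξ) i = ξ i :=
    fun i h1 h2 => primKnots_derivKnots h h1 (by omega)
  refine ⟨h.derivKnots hmult, rfl, ?_, ?_, ?_, hT, le_rfl, ?_⟩
  · show ξ (n - 1 + 1 + 1) = _
    rw [show n - 1 + 1 = n by omega]
  · show (knotList (q + 1) (n - 1 + 1) (primKnots (n - 1 + (q + 1)) (derivKnots ξ))).Sublist _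
    rw [knotList_congr he, show n - 1 + 1 = n by omega]
  · show splineSpace (q + 1) (n - 1 + 1) (primKnots (n - 1 + (q + 1)) (derivKnots ξ)) ⊆ _
    rw [splineSpace_congr (by omega) he, show n - 1 + 1 = n by omega]
  · simp [l2Start]

/-- The error grows by at most the indicator, exactly the amount subtracted from the tolerance; the
loop condition keeps the remainder positive. -/
theorem IsApproximation.step {q n kmax : ℕ} {ξ : ℕ → ℝ} {f : ℝ → ℝ} {T : ℝ} {S S' : State}
    (h : IsApproximation q n ξ f T S) (hf : Measurable f) (hs : Step q kmax S S') :
    IsApproximation q n ξ f T S' := by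
  obtain ⟨i₀, ⟨⟨hi, -⟩, hlt, -⟩, htol, hu, hξ', hn', -⟩ := hs
  have hle := xiNorm_update_le_indicator h.isOpen hi hu
  obtain ⟨hi1, hi2, hi3⟩ := hi
  obtain ⟨k', n', ξ', c', tol'⟩ := S'
  simp only at htol hu hξ' hn' hle
  subst hξ' hn'
  have hdim := h.isOpen.dim
  have hε : 0 ≤ indicator q S.n S.ξ S.c i₀ := (Real.sqrt_nonneg _).trans hle
  have hpe : ∀ i, 1 ≤ i → i ≤ S.n + 1 - 1 + (q + 1) + 1 →
      primKnots (S.n - 1 + (q + 1)) (removeKnot i₀ S.ξ) i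
        = removeKnot (i₀ + 1) (primKnots (S.n + (q + 1)) S.ξ) i :=
    fun i _ h2 => primKnots_removeKnot hi1 hi2 (by omega)
  have hnn : S.n - 1 + 1 = S.n + 1 - 1 := by omega
  refine ⟨h.isOpen.removeKnot hi1 hi2, ?_, ?_, ?_, ?_, ?_, ?_, ?_⟩
  · rw [← h.left]; exact if_pos (by omega)
  · show removeKnot i₀ S.ξ (S.n - 1 + 1) = _
    rw [← h.right, show S.n - 1 + 1 = S.n by omega]; exact if_neg (by omega)
  · simp only
    rw [hnn, knotList_congr hpe]
    exact (knotList_removeKnot_sublist (by omega) (by omega)).trans h.sublist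
  · simp only
    rw [hnn, splineSpace_congr (by omega) hpe]
    exact (splineSpace_removeKnot_subset h.isOpen.primKnots.mono (by omega) (by omega)).trans
      h.subset
  · simp only; linarith
  · have := h.tol_le
    simp only; linarith
  · simp only
    have hsplit : (fun x => f x - spline q (S.n - 1) (removeKnot i₀ S.ξ) c' x)
        = (fun x => f x - spline q S.n S.ξ S.c x)
          - spline q S.n S.ξ (fun i => insertCoeff q S.ξ i₀ c' i - S.c i) := by
      funext x
      rw [Pi.sub_apply, ← spline_sub, spline_removeKnot h.isOpen.mono hi1 hi2]
      ring
    have h1 := eLpNorm_spline_le h.isOpen fun i => insertCoeff q S.ξ i₀ c' i - S.c i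
    rw [h.left, h.right] at h1
    rw [hsplit, htol, show T - (S.tol - indicator q S.n S.ξ S.c i₀)
      = (T - S.tol) + indicator q S.n S.ξ S.c i₀ by ring,
      ENNReal.ofReal_add (sub_nonneg.2 h.tol_le) hε]
    refine (eLpNorm_sub_le (hf.sub (measurable_spline _ _ _ _)).aestronglyMeasurable
      (measurable_spline _ _ _ _).aestronglyMeasurable (by norm_num)).trans
      (add_le_add h.error (h1.trans (ENNReal.ofReal_le_ofReal hle)))

theorem IsApproximation.of_reaches {q n N : ℕ} {ξ θ c : ℕ → ℝ} {f : ℝ → ℝ} {T : ℝ} {S : State}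
    (h : IsApproximation q n ξ f T (l2Start N θ c T)) (hf : Measurable f)
    (hr : L2Reaches q N θ c T S) : IsApproximation q n ξ f T S := by
  unfold L2Reaches at hr
  induction hr with
  | refl => exact h
  | tail _ hs ih => exact ih.step hf hs

/-- The loop cannot get stuck: least squares solutions exist, and multiplicities of at most `q + 1`
make the window admissible. -/
theorem exists_step {q kmax : ℕ} {S : State} (h : IsOpenKnotVector q S.n S.ξ)
    (hS : ¬ Halted q kmax S) : ∃ S', Step q kmax S S' := by
  obtain ⟨i₀, hi⟩ := not_not.1 hS
  have hm := h.mult i₀ hi.1.1.1 hi.1.1.2.1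
  obtain ⟨c', hc'⟩ := exists_isUpdate (p := q) (ℓ := knotMultiplicity q S.n S.ξ (S.ξ i₀) - 1)
    (i₀ := i₀) (by have := hi.1.1.1; omega) (by omega) S.ξ S.c
  exact ⟨⟨S.k + 1, S.n - 1, removeKnot i₀ S.ξ, c', S.tol - indicator q S.n S.ξ S.c i₀⟩,
    i₀, hi, rfl, hc', rfl, rfl, rfl⟩

/-- The counter increases by one per pass and stays below `kmax` on entry. -/
theorem l2Finishes_of_isOpen {q N : ℕ} {θ c : ℕ → ℝ} {T : ℝ}
    (h : ∀ S, L2Reaches q N θ c T S → IsOpenKnotVector q S.n S.ξ) : L2Finishes q N θ c T := by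
  refine ⟨?_, fun S hS hH => exists_step (h S hS) hH⟩
  rintro ⟨σ, h0, hσ⟩
  have hk : ∀ m, (σ m).k = m := by
    intro m
    induction m with
    | zero => rw [h0]; rfl
    | succ m ih =>
      obtain ⟨i₀, -, -, -, -, -, hk⟩ := hσ m
      rw [hk, ih]
  obtain ⟨i₀, ⟨-, -, hlt⟩, -⟩ := hσ (numInterior q N)
  rw [hk] at hlt
  exact lt_irrefl _ hlt

theorem exists_l2Returns {q N : ℕ} {θ c : ℕ → ℝ} {T : ℝ}
    (h : ∀ S, L2Reaches q N θ c T S → ¬ Halted q (numInterior q N) S →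
      ∃ S', Step q (numInterior q N) S S') : ∃ S, L2Returns q N θ c T S := by
  have key : ∀ m S, L2Reaches q N θ c T S → numInterior q N - S.k ≤ m →
      ∃ S, L2Returns q N θ c T S := by
    intro m
    induction m with
    | zero =>
      intro S hS hk
      exact ⟨S, hS, fun ⟨i₀, _, _, hlt⟩ => by omega⟩
    | succ m ih =>
      intro S hS hk
      by_cases hH : Halted q (numInterior q N) S
      · exact ⟨S, hS, hH⟩
      · obtain ⟨S', hS'⟩ := h S hS hH
        refine ih S' (hS.tail hS') ?_
        obtain ⟨i₀, -, -, -, -, -, hk'⟩ := hS'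
        omega
  exact key _ _ Relation.ReflTransGen.refl le_rfl

/-- The primitive of an approximation of the derivative is close to the given spline. -/
theorem h1Norm_primitive_lt {q n : ℕ} {ξ c : ℕ → ℝ} (h : IsOpenKnotVector (q + 1) n ξ)
    (hmult : ∀ i, q + 3 ≤ i → i ≤ n → knotMultiplicity (q + 1) n ξ (ξ i) ≤ q + 1) {tol : ℝ}
    {S : State}
    (hS : IsApproximation q n ξ (spline q (n - 1) (derivKnots ξ) (derivCoeff (q + 1) ξ c))
      (h1Tol (q + 1) n ξ tol) S) :
    h1Norm (ξ (q + 2)) (ξ (n + 1)) (fun x => spline (q + 1) n ξ c x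
      - spline (q + 1) (S.n + 1) (primKnots (S.n + (q + 1)) S.ξ)
        (primCoeff (q + 1) (primKnots (S.n + (q + 1)) S.ξ) (c 1) S.c) x) < ENNReal.ofReal tol := by
  have hdim := h.dim
  have hp := hS.isOpen.primKnots
  have hpl : KnotRemoval.primKnots (S.n + (q + 1)) S.ξ (q + 2) = ξ (q + 2) :=
    (primKnots_succ (by omega) (by omega)).trans hS.left
  have hpr : KnotRemoval.primKnots (S.n + (q + 1)) S.ξ (S.n + 1 + 1) = ξ (n + 1) :=
    (primKnots_succ (by omega) (by omega)).trans hS.right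
  have hd := h.derivKnots hmult
  have hdr : derivKnots ξ (n - 1 + 1) = ξ (n + 1) := by
    rw [derivKnots, show n - 1 + 1 = n by omega]
  have hc1 := continuousOn_spline h
    (fun i h1 h2 => lt_of_knotMultiplicity_le h.mono hmult h1 h2) c
  have hc2 := continuousOn_spline hp (fun i h1 h2 => primKnots_lt hS.isOpen h1 h2)
    (primCoeff (q + 1) (primKnots (S.n + (q + 1)) S.ξ) (c 1) S.c)
  rw [hpl, hpr] at hc2
  have hm1 := memLp_spline hd.toIsBasicKnotVector (derivCoeff (q + 1) ξ c) 2
  have hm2 := memLp_spline hS.isOpen.toIsBasicKnotVector S.c 2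
  rw [hdr] at hm1
  rw [hS.left, hS.right] at hm2
  have hsqrt : 0 < √((ξ (n + 1) - ξ (q + 2)) ^ 2 + 1) := Real.sqrt_pos.2 (by positivity)
  refine h1Norm_lt h.lt (hc1.sub hc2) (v := fun x => spline q (n - 1) (derivKnots ξ)
    (derivCoeff (q + 1) ξ c) x - spline q S.n S.ξ S.c x) (fun x hx => ?_) ?_ (hm1.sub hm2)
    (sub_nonneg.2 hS.tol_le) hS.error ?_
  · have h2 := hasDerivWithinAt_spline hp
      (primCoeff (q + 1) (primKnots (S.n + (q + 1)) S.ξ) (c 1) S.c) (hpr.symm ▸ hx.2)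
    rw [Nat.add_sub_cancel, spline_derivCoeff_primCoeff hS.isOpen] at h2
    exact ((hasDerivWithinAt_spline h c hx.2).sub h2).mono Ioi_subset_Ici_self
  · have h3 := spline_left_endpoint hp (primCoeff (q + 1) (primKnots (S.n + (q + 1)) S.ξ) (c 1) S.c)
    rw [hpl] at h3
    rw [spline_left_endpoint h, h3]
    exact sub_self _
  · have h4 : h1Tol (q + 1) n ξ tol * √((ξ (n + 1) - ξ (q + 2)) ^ 2 + 1) = tol := by
      unfold h1Tol
      exact div_mul_cancel₀ _ hsqrt.ne'
    -- The error bound is the initial tolerance minus a positive remainder, hence strictly smaller.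
    calc _ < h1Tol (q + 1) n ξ tol * √((ξ (n + 1) - ξ (q + 2)) ^ 2 + 1) :=
          mul_lt_mul_of_pos_right (by linarith [hS.tol_pos]) hsqrt
      _ = tol := h4

end KnotRemoval

/-! ### The theorem -/

theorem theorem8 (p n : ℕ) (hp : 1 ≤ p) (ξ c : ℕ → ℝ)
    (hξ : IsOpenKnotVector p n ξ)
    (hmult : ∀ i, p + 2 ≤ i → i ≤ n → knotMultiplicity p n ξ (ξ i) ≤ p)
    (tol : ℝ) (htol : 0 < tol) :
    H1Finishes p n ξ c tol ∧
    (∃ n' ξ' c' nhat ξhat chat, H1Returns p n ξ c tol n' ξ' c' nhat ξhat chat) ∧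
    (∀ x ∈ Set.Ico (ξ (p + 1)) (ξ (n + 1)),
      HasDerivWithinAt (spline p n ξ c)
        (spline (p - 1) (n - 1) (derivKnots ξ) (derivCoeff p ξ c) x) (Set.Ici x) x) ∧
    ∀ n' ξ' c' nhat ξhat chat, H1Returns p n ξ c tol n' ξ' c' nhat ξhat chat →
      IsOpenKnotVector p nhat ξhat ∧
      ξhat (p + 1) = ξ (p + 1) ∧ ξhat (nhat + 1) = ξ (n + 1) ∧
      (knotList p nhat ξhat).Sublist (knotList p n ξ) ∧
      spline p nhat ξhat chat ∈ splineSpace p nhat ξhat ∧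
      splineSpace p nhat ξhat ⊆ splineSpace p n ξ ∧
      spline p nhat ξhat chat (ξ (p + 1)) = spline p n ξ c (ξ (p + 1)) ∧
      (∀ x ∈ Set.Icc (ξ (p + 1)) (ξ (n + 1)),
        spline p nhat ξhat chat x =
          spline p n ξ c (ξ (p + 1)) + ∫ t in (ξ (p + 1))..x, spline (p - 1) n' ξ' c' t) ∧
      h1Norm (ξ (p + 1)) (ξ (n + 1)) (fun x => spline p n ξ c x - spline p nhat ξhat chat x)
        < ENNReal.ofReal tol := by
  obtain ⟨q, rfl⟩ : ∃ q, p = q + 1 := ⟨p - 1, by omega⟩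
  have hT : 0 < h1Tol (q + 1) n ξ tol := div_pos htol (Real.sqrt_pos.2 (by positivity))
  have happ : ∀ S, L2Reaches q (n - 1) (derivKnots ξ) (derivCoeff (q + 1) ξ c)
      (h1Tol (q + 1) n ξ tol) S → IsApproximation q n ξ
        (spline q (n - 1) (derivKnots ξ) (derivCoeff (q + 1) ξ c)) (h1Tol (q + 1) n ξ tol) S :=
    fun S hS => (isApproximation_start hξ hmult _ hT).of_reaches (measurable_spline _ _ _ _) hS
  have hfin : L2Finishes q (n - 1) (derivKnots ξ) (derivCoeff (q + 1) ξ c)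
      (h1Tol (q + 1) n ξ tol) := l2Finishes_of_isOpen fun S hS => (happ S hS).isOpen
  refine ⟨hfin, ?_, fun x hx => hasDerivWithinAt_spline hξ c hx.2, ?_⟩
  · obtain ⟨S, hS⟩ := exists_l2Returns hfin.2
    exact ⟨_, _, _, _, _, _, ⟨S, hS, rfl, rfl, rfl⟩, rfl, rfl, rfl⟩
  · rintro n' ξ' c' nhat ξhat chat ⟨⟨S, ⟨hS, -⟩, rfl, rfl, rfl⟩, rfl, rfl, rfl⟩
    have hA := happ S hS
    have hp := hA.isOpen.primKnots
    have hdim := hA.isOpen.dim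
    have hpl : primKnots (S.n + (q + 1)) S.ξ (q + 1 + 1) = ξ (q + 1 + 1) :=
      (primKnots_succ (by omega) (by omega)).trans hA.left
    have hpr : primKnots (S.n + (q + 1)) S.ξ (S.n + 1 + 1) = ξ (n + 1) :=
      (primKnots_succ (by omega) (by omega)).trans hA.right
    refine ⟨hp, hpl, hpr, hA.sublist, ⟨_, fun _ _ => rfl⟩, hA.subset, ?_, fun x hx => ?_,
      h1Norm_primitive_lt hξ hmult hA⟩
    · rw [spline_left_endpoint hξ, ← hpl, spline_left_endpoint hp]
      rfl
    · have h1 := spline_primCoeff_eq_integral hA.isOpen (c 1) S.c (x := x)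
        (by rw [hA.left, hA.right]; exact hx)
      rw [h1, spline_left_endpoint hξ, hA.left]
      rfl
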